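/- Let $d\geq 1$, and let $\mathbb{L}^d=(\mathbb{Z}^d,\mathbb{E}^d)$ be the hypercubic lattice, whose edges are the unordered pairs $[x,y]$ of points of $\mathbb{Z}^d$ at Euclidean distance $1$. For $p\in(0,1)$ let $\mathbb{P}$ be the product measure on $\Omega=\{0,1\}^{\mathbb{E}^d}$ under which the coordinates $\omega_{[x,y]}$ are independent and equal to $1$ with probability $p$, and let $\mathcal{G}^{(\omega)}$ be the graph on $\mathbb{Z}^d$ with edge set $\{[x,y]\in\mathbb{E}^d:\omega_{[x,y]}=1\}$. On the complex Hilbert space $\ell^2(\mathbb{Z}^d)$ let $D^{(\omega)}$ be multiplication by the vertex degree of $\mathcal{G}^{(\omega)}$, let $(A^{(\omega)}\varphi)(x)=\sum_{y:\,\omega_{[x,y]}=1}\varphi(y)$, and put $$\Delta_{\mathrm N}^{(\omega)}=D^{(\omega)}-A^{(\omega)},\qquad \Delta_{\widetilde{\mathrm D}}^{(\omega)}=(2d-D^{(\omega)})+\Delta_{\mathrm N}^{(\omega)},\qquad \Delta_{\mathrm D}^{(\omega)}=2(2d-D^{(\omega)})+\Delta_{\mathrm N}^{(\omega)}.$$ Let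 $p_c=\sup\{q\in[0,1]:$ for bond probability $q$ the cluster of the origin is almost surely finite$\}$ be the critical probability. For a bounded self-adjoint operator $B$ on a Hilbert space $H$ and $\varphi\in H$, let $\mu_\varphi$ be the spectral measure, $\int f\,d\mu_\varphi=\langle\varphi,f(B)\varphi\rangle$; for $\varkappa\in\{\mathrm{pp},\mathrm{sc},\mathrm{ac}\}$ let $H_\varkappa$ be the closed $B$-invariant subspace of those $\varphi$ for which $\mu_\varphi$ is pure point, singular continuous, or absolutely continuous, respectively, and let $\mathrm{spec}_\varkappa(B)$ be the spectrum of $B$ restricted to $H_\varkappa$. Fix $\mathrm X\in\{\mathrm N,\widetilde{\mathrm D},\mathrm D\}$ and $p\in(0,1)$. Then: 1. $\omega\mapsto\Delta_{\mathrm X}^{(\omega)}$ is an ergodic random operator with respect to $\mathbb{Z}^d$-translations: every $\Delta_{\mathrm X}^{(\omega)}$ is bounded and self-adjoint; $\omega\mapsto\langle\varphi,\Delta_{\mathrm X}^{(\omega)}\psi\rangle$ is measurable for all $\varphi,\psi$; the translations $\tau_z\omega=(\omega_{[x+z,y+z]})_{[x,y]}$, $z\in\mathbb{Z}^d$, form a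 $\mathbb{P}$-preserving ergodic group action on $\Omega$; and $\Delta_{\mathrm X}^{(\tau_z\omega)}=T_z^{-1}\Delta_{\mathrm X}^{(\omega)}T_z$ for all $z$ and $\omega$, where $(T_z\varphi)(x)=\varphi(x-z)$. 2. $\mathrm{spec}(\Delta_{\mathrm X}^{(\omega)})=[0,4d]$ for $\mathbb{P}$-almost every $\omega$. 3. For every $\varkappa\in\{\mathrm{pp},\mathrm{sc},\mathrm{ac}\}$ there is a closed (non-random, possibly empty) set $\Sigma_{\mathrm X}^{(\varkappa)}\subset\mathbb{R}$ such that $\mathrm{spec}_\varkappa(\Delta_{\mathrm X}^{(\omega)})=\Sigma_{\mathrm X}^{(\varkappa)}$ for $\mathbb{P}$-almost every $\omega$. 4. If $p<p_c$, then there is a (non-random) set $S\subset\mathbb{R}$ that is dense in $[0,4d]$, i.e. $\overline{S}=[0,4d]$, such that for $\mathbb{P}$-almost every $\omega$ the spectrum of $\Delta_{\mathrm X}^{(\omega)}$ is only pure point, i.e. $H_{\mathrm{pp}}=\ell^2(\mathbb{Z}^d)$, $\mathrm{spec}_{\mathrm{pp}}(\Delta_{\mathrm X}^{(\omega)})=[0,4d]$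 and $\mathrm{spec}_{\mathrm{sc}}(\Delta_{\mathrm X}^{(\omega)})=\mathrm{spec}_{\mathrm{ac}}(\Delta_{\mathrm X}^{(\omega)})=\varnothing$; the set of eigenvalues of $\Delta_{\mathrm X}^{(\omega)}$ is exactly $S$; and every eigenvalue has an infinite-dimensional eigenspace. -/

import Mathlib

open MeasureTheory
open scoped CompactlySupported ENNReal InnerProductSpace unitInterval

noncomputable section
namespace PercLap

section Spectral
variable {H : Type*} [NormedAddCommGroup H] [InnerProductSpace ℂ H] [CompleteSpace H]

/-- The positive linear functional `f ↦ ⟨φ, f(A) φ⟩` on compactly supported continuous functions,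
with `f(A)` given by the continuous functional calculus. -/
def spectralFunctional (A : H →L[ℂ] H) (φ : H) : C_c(ℝ, ℝ) →ₚ[ℝ] ℝ :=
  PositiveLinearMap.mk₀
    { toFun := fun f => (⟪φ, cfc (f : ℝ → ℝ) A φ⟫_ℂ).re
      map_add' := fun f g => by
        have h := cfc_add (R := ℝ) A (f : ℝ → ℝ) (g : ℝ → ℝ) f.continuous.continuousOn
          g.continuous.continuousOn
        have h' : (⇑(f + g) : ℝ → ℝ) = fun x => f x + g x := rfl
        rw [h', h, add_apply, inner_add_right, Complex.add_re]
      map_smul' := fun c f => by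
        have h := cfc_const_mul (R := ℝ) c (f : ℝ → ℝ) A f.continuous.continuousOn
        have h' : (⇑(c • f) : ℝ → ℝ) = fun x => c * f x := rfl
        rw [h', h, ← algebraMap_smul ℂ c (cfc (f : ℝ → ℝ) A), smul_apply,
          inner_smul_right]
        simp }
    (fun f hf => by
      have h : (0 : H →L[ℂ] H) ≤ cfc (f : ℝ → ℝ) A := cfc_nonneg fun x _ => hf x
      exact (ContinuousLinearMap.nonneg_iff_isPositive _ |>.1 h).re_inner_nonneg_right φ)

/-- The spectral measure `μ_φ` of the vector `φ` with respect to a bounded self-adjoint operator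
`A`: the unique regular Borel measure on `ℝ` with `∫ f dμ_φ = ⟨φ, f(A) φ⟩` for all continuous
compactly supported `f`. -/
def spectralMeasure (A : H →L[ℂ] H) (φ : H) : Measure ℝ :=
  RealRMK.rieszMeasure (spectralFunctional A φ)

instance (A : H →L[ℂ] H) (φ : H) : (spectralMeasure A φ).Regular :=
  RealRMK.regular_rieszMeasure _

theorem integral_spectralMeasure (A : H →L[ℂ] H) (φ : H) (f : C_c(ℝ, ℝ)) :
    ∫ x, f x ∂(spectralMeasure A φ) = (⟪φ, cfc (f : ℝ → ℝ) A φ⟫_ℂ).re :=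
  RealRMK.integral_rieszMeasure (spectralFunctional A φ) f

theorem integrable_Cc (μ : Measure ℝ) [IsLocallyFiniteMeasure μ] (f : C_c(ℝ, ℝ)) :
    Integrable (f : ℝ → ℝ) μ :=
  f.continuous.integrable_of_hasCompactSupport f.hasCompactSupport

theorem spectralMeasure_zero (A : H →L[ℂ] H) : spectralMeasure A 0 = 0 := by
  refine Measure.ext_of_integral_eq_on_compactlySupported fun f => ?_
  simp [integral_spectralMeasure]

theorem isLocallyFiniteMeasure_add (μ ν : Measure ℝ) [IsLocallyFiniteMeasure μ]
    [IsLocallyFiniteMeasure ν] : IsLocallyFiniteMeasure (μ + ν) := by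
  refine ⟨fun x => ?_⟩
  obtain ⟨s, hs, hμ⟩ := μ.finiteAt_nhds x
  obtain ⟨t, ht, hν⟩ := ν.finiteAt_nhds x
  refine ⟨s ∩ t, Filter.inter_mem hs ht, ?_⟩
  rw [Measure.add_apply, ENNReal.add_lt_top]
  exact ⟨(measure_mono Set.inter_subset_left).trans_lt hμ,
    (measure_mono Set.inter_subset_right).trans_lt hν⟩

theorem spectralMeasure_parallelogram (A : H →L[ℂ] H) (φ ψ : H) :
    spectralMeasure A (φ + ψ) + spectralMeasure A (φ - ψ) =
      (spectralMeasure A φ + spectralMeasure A φ) +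
        (spectralMeasure A ψ + spectralMeasure A ψ) := by
  have := isLocallyFiniteMeasure_add (spectralMeasure A (φ + ψ)) (spectralMeasure A (φ - ψ))
  have := isLocallyFiniteMeasure_add (spectralMeasure A φ) (spectralMeasure A φ)
  have := isLocallyFiniteMeasure_add (spectralMeasure A ψ) (spectralMeasure A ψ)
  have := isLocallyFiniteMeasure_add (spectralMeasure A φ + spectralMeasure A φ)
    (spectralMeasure A ψ + spectralMeasure A ψ)
  refine Measure.ext_of_integral_eq_on_compactlySupported fun f => ?_
  simp only [integral_add_measure, integrable_Cc, integral_spectralMeasure, map_add, map_sub,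
    inner_add_left, inner_add_right, inner_sub_left, inner_sub_right, Complex.add_re,
    Complex.sub_re]
  ring

theorem spectralMeasure_smul (A : H →L[ℂ] H) (c : ℂ) (φ : H) :
    spectralMeasure A (c • φ) = (Real.toNNReal (‖c‖ ^ 2)) • spectralMeasure A φ := by
  refine Measure.ext_of_integral_eq_on_compactlySupported fun f => ?_
  rw [integral_smul_nnreal_measure, integral_spectralMeasure, integral_spectralMeasure, map_smul,
    inner_smul_left, inner_smul_right, ← mul_assoc, mul_comm ((starRingEnd ℂ) c), Complex.mul_conj,
    Complex.normSq_eq_norm_sq, Complex.re_ofReal_mul, NNReal.smul_def,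
    Real.coe_toNNReal _ (by positivity), smul_eq_mul]

theorem spectralMeasure_of_not_isSelfAdjoint {A : H →L[ℂ] H} (hA : ¬ IsSelfAdjoint A) (φ : H) :
    spectralMeasure A φ = 0 := by
  refine Measure.ext_of_integral_eq_on_compactlySupported fun f => ?_
  rw [integral_spectralMeasure, cfc_apply_of_not_predicate A hA]
  simp

theorem spectralMeasure_apply_self {A : H →L[ℂ] H} (hA : IsSelfAdjoint A) (φ : H) :
    spectralMeasure A (A φ) =
      (spectralMeasure A φ).withDensity fun x => ENNReal.ofReal (x ^ 2) := by
  have : IsLocallyFiniteMeasure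
      ((spectralMeasure A φ).withDensity fun x => ENNReal.ofReal (x ^ 2)) :=
    IsLocallyFiniteMeasure.withDensity_ofReal (by fun_prop)
  refine Measure.ext_of_integral_eq_on_compactlySupported fun f => ?_
  let g : C_c(ℝ, ℝ) := ⟨⟨fun x => x * (f x * x), by fun_prop⟩, by
    exact (f.hasCompactSupport.mul_right (f' := fun x => x)).mul_left (f := fun x => x)⟩
  have hg : (g : ℝ → ℝ) = fun x => x * (f x * x) := rfl
  have hc : ContinuousOn (f : ℝ → ℝ) (spectrum ℝ A) := f.continuous.continuousOn
  have h1 : cfc (g : ℝ → ℝ) A = A * (cfc (f : ℝ → ℝ) A * A) := by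
    rw [hg, cfc_mul (fun x : ℝ => x) (fun x => f x * x) A,
      cfc_mul (f : ℝ → ℝ) (fun x => x) A, cfc_id' ℝ A]
  rw [integral_spectralMeasure, integral_withDensity_eq_integral_toReal_smul (by fun_prop)
    (by simp)]
  have h2 : ∫ x, (ENNReal.ofReal (x ^ 2)).toReal • f x ∂(spectralMeasure A φ) =
      ∫ x, g x ∂(spectralMeasure A φ) := by
    refine integral_congr_ae (.of_forall fun x => ?_)
    simp only [hg, ENNReal.toReal_ofReal (sq_nonneg x), smul_eq_mul]
    ring
  rw [h2, integral_spectralMeasure, h1]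
  simp only [mul_apply_eq_comp]
  rw [← ContinuousLinearMap.adjoint_inner_left A, ← ContinuousLinearMap.star_eq_adjoint, hA.star_eq]

/-- The three types in the Lebesgue decomposition: pure point, singular continuous and
absolutely continuous. -/
inductive SpectralType
  | pp
  | sc
  | ac

/-- A Borel measure on `ℝ` is of pure point, singular continuous or absolutely continuous type. -/
def SpectralType.Holds : SpectralType → Measure ℝ → Prop
  | .pp, μ => ∃ S : Set ℝ, S.Countable ∧ μ Sᶜ = 0
  | .sc, μ => (∀ x, μ {x} = 0) ∧ Measure.MutuallySingular μ volume
  | .ac, μ => Measure.AbsolutelyContinuous μ volume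

theorem SpectralType.holds_zero (κ : SpectralType) : κ.Holds 0 := by
  cases κ
  · exact ⟨∅, by simp, by simp⟩
  · exact ⟨by simp, Measure.MutuallySingular.zero_left⟩
  · exact Measure.AbsolutelyContinuous.zero _

theorem SpectralType.Holds.mono {κ : SpectralType} {μ ν : Measure ℝ} (h : κ.Holds μ)
    (hν : ν ≪ μ) : κ.Holds ν := by
  cases κ
  · obtain ⟨S, hS, h0⟩ := h
    exact ⟨S, hS, hν h0⟩
  · exact ⟨fun x => hν (h.1 x), h.2.mono_ac hν .rfl⟩
  · exact hν.trans h

theorem SpectralType.Holds.add {κ : SpectralType} {μ ν : Measure ℝ} (h : κ.Holds μ)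
    (h' : κ.Holds ν) : κ.Holds (μ + ν) := by
  cases κ
  · obtain ⟨S, hS, h0⟩ := h
    obtain ⟨T, hT, h1⟩ := h'
    refine ⟨S ∪ T, hS.union hT, ?_⟩
    rw [Measure.add_apply, measure_mono_null (by simp) h0, measure_mono_null (by simp) h1,
      add_zero]
  · exact ⟨fun x => by simp [h.1 x, h'.1 x], h.2.add_left h'.2⟩
  · exact Measure.AbsolutelyContinuous.add_left h h'

/-- The spectral subspace `H_κ`: all vectors whose spectral measure is purely of type `κ`. -/
def spectralSubspace (A : H →L[ℂ] H) (κ : SpectralType) : Submodule ℂ H where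
  carrier := {φ | κ.Holds (spectralMeasure A φ)}
  zero_mem' := by
    rw [Set.mem_ofPred_eq, spectralMeasure_zero]
    exact κ.holds_zero
  add_mem' := fun {φ ψ} hφ hψ =>
    ((hφ.add hφ).add (hψ.add hψ)).mono <| by
      rw [← spectralMeasure_parallelogram]
      exact Measure.AbsolutelyContinuous.rfl.add_right _
  smul_mem' := fun c φ hφ => by
    rw [Set.mem_ofPred_eq, spectralMeasure_smul]
    exact SpectralType.Holds.mono hφ (Measure.smul_absolutelyContinuous)

theorem mapsTo_spectralSubspace (A : H →L[ℂ] H) (κ : SpectralType) :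
    Set.MapsTo A (spectralSubspace A κ) (spectralSubspace A κ) := by
  intro φ hφ
  change κ.Holds (spectralMeasure A (A φ))
  by_cases hA : IsSelfAdjoint A
  · rw [spectralMeasure_apply_self hA]
    exact SpectralType.Holds.mono hφ (withDensity_absolutelyContinuous _ _)
  · rw [spectralMeasure_of_not_isSelfAdjoint hA]
    exact κ.holds_zero

/-- The component `spec_κ(A)` of the spectrum: the spectrum of the restriction of `A` to the
spectral subspace `H_κ`. -/
def spectralComponent (A : H →L[ℂ] H) (κ : SpectralType) : Set ℂ :=
  spectrum ℂ (A.restrict (mapsTo_spectralSubspace A κ))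

end Spectral

section Lattice

/-- The vertex set `ℤ^d`. -/
abbrev Vertex (d : ℕ) : Type := Fin d → ℤ

/-- The hypercubic lattice: vertices are adjacent iff they have Euclidean distance one. -/
def lattice (d : ℕ) : SimpleGraph (Vertex d) where
  Adj x y := ∑ i, (x i - y i) ^ 2 = 1
  symm := ⟨fun x y h => by
    rw [← h]
    exact Finset.sum_congr rfl fun i _ => by ring⟩
  loopless := ⟨fun x h => by simp at h⟩

/-- The edges of the lattice, as unordered pairs of nearest neighbours. -/
abbrev Edge (d : ℕ) : Type := (lattice d).edgeSet

/-- The nearest neighbours of the origin. -/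
def unitVectors (d : ℕ) : Set (Vertex d) := {u | ∑ i, u i ^ 2 = 1}

theorem finite_unitVectors (d : ℕ) : (unitVectors d).Finite := by
  refine (Set.finite_Icc (-1 : Vertex d) 1).subset fun u hu => ?_
  have h : ∀ i, u i ^ 2 ≤ 1 := fun i => by
    rw [← (show ∑ i, u i ^ 2 = 1 from hu)]
    exact Finset.single_le_sum (f := fun i => u i ^ 2) (fun j _ => sq_nonneg _)
      (Finset.mem_univ i)
  exact ⟨fun i => (abs_le.1 ((sq_le_one_iff_abs_le_one _).1 (h i))).1,
    fun i => (abs_le.1 ((sq_le_one_iff_abs_le_one _).1 (h i))).2⟩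

theorem lattice_adj_iff {d : ℕ} (x y : Vertex d) :
    (lattice d).Adj x y ↔ y - x ∈ unitVectors d := by
  change ∑ i, (x i - y i) ^ 2 = 1 ↔ ∑ i, (y i - x i) ^ 2 = 1
  rw [Finset.sum_congr rfl fun i _ => show (x i - y i) ^ 2 = (y i - x i) ^ 2 by ring]

theorem finite_neighborSet {d : ℕ} {G : SimpleGraph (Vertex d)} (hG : G ≤ lattice d)
    (x : Vertex d) : (G.neighborSet x).Finite := by
  refine ((finite_unitVectors d).image (x + ·)).subset fun y hy => ?_
  exact ⟨y - x, (lattice_adj_iff x y).1 (hG hy), by simp⟩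

/-- The finite set of neighbours of `x` in a subgraph `G` of the lattice. -/
def neighbors {d : ℕ} {G : SimpleGraph (Vertex d)} (hG : G ≤ lattice d) (x : Vertex d) :
    Finset (Vertex d) :=
  (finite_neighborSet hG x).toFinset

theorem mem_neighbors {d : ℕ} {G : SimpleGraph (Vertex d)} (hG : G ≤ lattice d)
    (x y : Vertex d) : y ∈ neighbors hG x ↔ G.Adj x y := by
  simp [neighbors]

/-- The vertex degree of `x` in a subgraph `G` of the lattice. -/
def vertexDegree {d : ℕ} {G : SimpleGraph (Vertex d)} (hG : G ≤ lattice d) (x : Vertex d) : ℕ :=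
  (neighbors hG x).card

theorem vertexDegree_le {d : ℕ} {G : SimpleGraph (Vertex d)} (hG : G ≤ lattice d)
    (x : Vertex d) : vertexDegree hG x ≤ (finite_unitVectors d).toFinset.card := by
  refine Finset.card_le_card_of_injOn (fun y => y - x) (fun y hy => ?_)
    (fun y _ z _ h => sub_left_injective h)
  have h : G.Adj x y := (mem_neighbors hG x y).1 hy
  simpa using (lattice_adj_iff x y).1 (hG h)

/-- The Hilbert space `ℓ²(ℤ^d)` of complex-valued square-summable sequences. -/
abbrev L2 (d : ℕ) : Type := lp (fun _ : Vertex d => ℂ) 2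

theorem memLp_two_iff {ι : Type*} (f : ι → ℂ) :
    Memℓp f 2 ↔ Summable fun x => ‖f x‖ ^ 2 := by
  rw [memℓp_gen_iff (by simp)]
  simp

theorem norm_sq_eq_tsum {d : ℕ} (φ : L2 d) : ‖φ‖ ^ 2 = ∑' x, ‖φ x‖ ^ 2 := by
  have h := lp.norm_rpow_eq_tsum (p := 2) (by simp) φ
  simpa using h

/-- Multiplication by a bounded function on `ℓ²(ℤ^d)`. -/
def mulOp {d : ℕ} (f : Vertex d → ℂ) (C : ℝ) (hf : ∀ x, ‖f x‖ ≤ C) : L2 d →L[ℂ] L2 d :=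
  have key : ∀ (φ : L2 d) (x : Vertex d), ‖f x * φ x‖ ^ 2 ≤ C ^ 2 * ‖φ x‖ ^ 2 := fun φ x => by
    rw [norm_mul, mul_pow]
    gcongr
    exact hf x
  have hs : ∀ φ : L2 d, Summable fun x => C ^ 2 * ‖φ x‖ ^ 2 := fun φ =>
    ((memLp_two_iff _).1 φ.2).mul_left _
  have hm : ∀ φ : L2 d, Memℓp (fun x => f x * φ x) 2 := fun φ =>
    (memLp_two_iff _).2 ((hs φ).of_nonneg_of_le (fun x => by positivity) (key φ))
  LinearMap.mkContinuous
    { toFun := fun φ => ⟨fun x => f x * φ x, hm φ⟩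
      map_add' := fun φ ψ => by
        ext x
        exact mul_add _ _ _
      map_smul' := fun c φ => by
        ext x
        exact mul_left_comm _ _ _ }
    C
    (fun φ => by
      have hC : 0 ≤ C := (norm_nonneg _).trans (hf 0)
      refine le_of_sq_le_sq ?_ (by positivity)
      rw [mul_pow, norm_sq_eq_tsum, norm_sq_eq_tsum, ← tsum_mul_left]
      exact ((memLp_two_iff _).1 (hm φ)).tsum_le_tsum (key φ) (hs φ))

theorem mulOp_apply {d : ℕ} (f : Vertex d → ℂ) (C : ℝ) (hf : ∀ x, ‖f x‖ ≤ C) (φ : L2 d)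
    (x : Vertex d) : mulOp f C hf φ x = f x * φ x := rfl

theorem memLp_translate {d : ℕ} (z : Vertex d) (φ : L2 d) :
    Memℓp (fun x => φ (x - z)) 2 :=
  (memLp_two_iff _).2 ((Equiv.subRight z).summable_iff.2 ((memLp_two_iff _).1 φ.2))

/-- The unitary translation operator `(T_z φ)(x) = φ(x - z)` on `ℓ²(ℤ^d)`. -/
def translation {d : ℕ} (z : Vertex d) : L2 d ≃ₗᵢ[ℂ] L2 d where
  toFun φ := ⟨fun x => φ (x - z), memLp_translate z φ⟩
  invFun φ := ⟨fun x => φ (x - -z), memLp_translate (-z) φ⟩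
  map_add' φ ψ := rfl
  map_smul' c φ := rfl
  left_inv φ := by
    ext x
    exact congrArg φ (by simp)
  right_inv φ := by
    ext x
    exact congrArg φ (by simp)
  norm_map' φ := by
    refine (sq_eq_sq₀ (norm_nonneg _) (norm_nonneg _)).1 ?_
    rw [norm_sq_eq_tsum, norm_sq_eq_tsum]
    exact (Equiv.subRight z).tsum_eq fun x => ‖φ x‖ ^ 2

theorem translation_apply {d : ℕ} (z : Vertex d) (φ : L2 d) (x : Vertex d) :
    translation z φ x = φ (x - z) := rfl

/-- The degree operator `[D(G)φ](x) = d_G(x) φ(x)`. -/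
def degreeOp {d : ℕ} {G : SimpleGraph (Vertex d)} (hG : G ≤ lattice d) : L2 d →L[ℂ] L2 d :=
  mulOp (fun x => (vertexDegree hG x : ℂ)) ((finite_unitVectors d).toFinset.card : ℝ) fun x => by
    rw [Complex.norm_natCast]
    exact_mod_cast vertexDegree_le hG x

theorem degreeOp_apply {d : ℕ} {G : SimpleGraph (Vertex d)} (hG : G ≤ lattice d) (φ : L2 d)
    (x : Vertex d) : degreeOp hG φ x = vertexDegree hG x * φ x := rfl

/-- The bounded operator underlying the adjacency operator, written as a finite sum of cut-off
translations. -/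
def hoppingOp {d : ℕ} (G : SimpleGraph (Vertex d)) : L2 d →L[ℂ] L2 d :=
  ∑ u ∈ (finite_unitVectors d).toFinset,
    (mulOp (fun x => open Classical in if G.Adj x (x + u) then 1 else 0) 1
      fun x => by split_ifs <;> simp) ∘L
      ((translation (-u)).toContinuousLinearEquiv : L2 d →L[ℂ] L2 d)

theorem hoppingOp_apply {d : ℕ} {G : SimpleGraph (Vertex d)} (hG : G ≤ lattice d) (φ : L2 d)
    (x : Vertex d) : hoppingOp G φ x = ∑ y ∈ neighbors hG x, φ y := by
  classical
  have h1 : hoppingOp G φ x = ∑ u ∈ (finite_unitVectors d).toFinset,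
      (if G.Adj x (x + u) then (1 : ℂ) else 0) * φ (x - -u) := by
    rw [hoppingOp, sum_apply, lp.coeFn_sum, Finset.sum_apply]
    refine Finset.sum_congr rfl fun u _ => ?_
    change (ite _ _ _ : ℂ) * φ (x - -u) = _
    congr
  have h2 : ∀ u, (if G.Adj x (x + u) then (1 : ℂ) else 0) * φ (x - -u) =
      if G.Adj x (x + u) then φ (x + u) else 0 := fun u => by
    rw [sub_neg_eq_add]
    split_ifs <;> simp
  rw [h1, Finset.sum_congr rfl fun u _ => h2 u, ← Finset.sum_filter]
  refine Finset.sum_bij' (fun u _ => x + u) (fun y _ => y - x) ?_ ?_ ?_ ?_ ?_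
  · intro u hu
    exact (mem_neighbors hG x _).2 (Finset.mem_filter.1 hu).2
  · intro y hy
    have h := (mem_neighbors hG x y).1 hy
    refine Finset.mem_filter.2 ⟨?_, by simpa using h⟩
    simpa using (lattice_adj_iff x y).1 (hG h)
  · intro u _
    simp
  · intro y _
    simp
  · intro u _
    rfl

/-- The adjacency operator `[A(G)φ](x) = ∑_{y : [x,y] ∈ E} φ(y)`. -/
def adjacencyOp {d : ℕ} {G : SimpleGraph (Vertex d)} (hG : G ≤ lattice d) :
    L2 d →L[ℂ] L2 d where
  toFun φ := ⟨fun x => ∑ y ∈ neighbors hG x, φ y, by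
    rw [show (fun x => ∑ y ∈ neighbors hG x, φ y) = hoppingOp G φ from
      funext fun x => (hoppingOp_apply hG φ x).symm]
    exact (hoppingOp G φ).2⟩
  map_add' φ ψ := by
    ext x
    exact Finset.sum_add_distrib
  map_smul' c φ := by
    ext x
    exact (Finset.mul_sum _ _ _).symm
  cont := by
    refine (hoppingOp G).continuous.congr fun φ => ?_
    ext x
    exact hoppingOp_apply hG φ x

theorem adjacencyOp_apply {d : ℕ} {G : SimpleGraph (Vertex d)} (hG : G ≤ lattice d) (φ : L2 d)
    (x : Vertex d) : adjacencyOp hG φ x = ∑ y ∈ neighbors hG x, φ y := rfl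

/-- The three boundary conditions: Neumann, Pseudo-Dirichlet and Dirichlet. -/
inductive BoundaryCondition
  | neumann
  | pseudoDirichlet
  | dirichlet

/-- The Laplacian `Δ_X(G)` on `ℓ²(ℤ^d)`: `Δ_N = D - A`, `Δ_D̃ = (2d - D) + Δ_N` and
`Δ_D = 2(2d - D) + Δ_N`. -/
def laplacian {d : ℕ} (X : BoundaryCondition) {G : SimpleGraph (Vertex d)} (hG : G ≤ lattice d) :
    L2 d →L[ℂ] L2 d :=
  match X with
  | .neumann => degreeOp hG - adjacencyOp hG
  | .pseudoDirichlet => ((2 * d : ℂ) • 1 - degreeOp hG) + (degreeOp hG - adjacencyOp hG)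
  | .dirichlet => (2 : ℂ) • ((2 * d : ℂ) • 1 - degreeOp hG) + (degreeOp hG - adjacencyOp hG)

end Lattice

section Percolation

/-- The configuration space `{0,1}^E` of bond percolation, with its product σ-algebra; `true`
means that the bond is present. -/
abbrev Config (d : ℕ) : Type := Edge d → Bool

/-- The product measure under which bonds are independently present with probability `p`. -/
def percMeasure (d : ℕ) (p : I) : Measure (Config d) :=
  Measure.infinitePi fun _ : Edge d => ProbabilityTheory.bernoulliMeasure true false p

/-- The bond-percolation graph `(ℤ^d, {e | ω e = 1})`. -/
def percGraph {d : ℕ} (ω : Config d) : SimpleGraph (Vertex d) where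
  Adj x y := ∃ h : (lattice d).Adj x y, ω ⟨s(x, y), h⟩ = true
  symm := ⟨fun x y ⟨h, hω⟩ => ⟨h.symm, by
    rw [← hω]
    exact congrArg ω (Subtype.ext Sym2.eq_swap)⟩⟩
  loopless := ⟨fun _ h => h.1.ne rfl⟩

theorem percGraph_le {d : ℕ} (ω : Config d) : percGraph ω ≤ lattice d := fun _ _ h => h.1

/-- The Laplacian on the bond-percolation graph. -/
def percLaplacian {d : ℕ} (X : BoundaryCondition) (ω : Config d) : L2 d →L[ℂ] L2 d :=
  laplacian X (percGraph_le ω)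

/-- The vertex set of the cluster containing `x`. -/
def clusterOf {d : ℕ} (ω : Config d) (x : Vertex d) : Set (Vertex d) :=
  {y | (percGraph ω).Reachable x y}

/-- The critical bond probability: the supremum of those `p` for which the cluster of the origin
is almost surely finite. -/
def criticalProb (d : ℕ) : ℝ :=
  sSup ((fun p : I => (p : ℝ)) '' {p | percMeasure d p {ω | (clusterOf ω 0).Infinite} = 0})

theorem lattice_adj_add {d : ℕ} {x y : Vertex d} (z : Vertex d) (h : (lattice d).Adj x y) :
    (lattice d).Adj (x + z) (y + z) := by
  rw [lattice_adj_iff] at h ⊢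
  simpa using h

/-- The translate `[x+z, y+z]` of the edge `[x,y]`. -/
def Edge.shift {d : ℕ} (z : Vertex d) (e : Edge d) : Edge d :=
  ⟨Sym2.map (· + z) e.1, by
    obtain ⟨e, he⟩ := e
    induction e with
    | _ x y => exact lattice_adj_add z he⟩

/-- The translations `τ_z ω = (ω_{[x+z,y+z]})_{[x,y]}` of the configuration space. -/
def Config.shift {d : ℕ} (z : Vertex d) (ω : Config d) : Config d := fun e => ω (e.shift z)

/-- A random operator `ω ↦ A ω` with values in the bounded self-adjoint operators on `H` is
ergodic with respect to the group `Γ`, acting by `τ` on the probability space and by the unitary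
operators `U` on `H`, if it is (weakly) measurable, if `τ` is a measure-preserving ergodic action,
and if `A (τ_z ω) = U_z⁻¹ (A ω) U_z` for all `z` and `ω`. -/
structure IsErgodicRandomOperator {Γ Ω H : Type*} [AddGroup Γ] [MeasurableSpace Ω]
    [NormedAddCommGroup H] [InnerProductSpace ℂ H] [CompleteSpace H] (P : Measure Ω)
    (τ : Γ → Ω → Ω) (U : Γ → H ≃ₗᵢ[ℂ] H) (A : Ω → H →L[ℂ] H) : Prop where
  isSelfAdjoint : ∀ ω, IsSelfAdjoint (A ω)
  measurable_inner : ∀ φ ψ : H, Measurable fun ω => ⟪φ, A ω ψ⟫_ℂ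
  shift_zero : ∀ ω, τ 0 ω = ω
  shift_add : ∀ z w ω, τ (z + w) ω = τ z (τ w ω)
  measurePreserving : ∀ z, MeasurePreserving (τ z) P P
  ergodic : ∀ s, MeasurableSet s → (∀ z, τ z ⁻¹' s = s) → P s = 0 ∨ P s = 1
  covariant : ∀ z ω φ, A (τ z ω) φ = (U z).symm (A ω (U z φ))

end Percolation

end PercLap

end

open PercLap

/-
The Laplacian is covariant under lattice translations, and translations act ergodically on
configurations because distant cylinders are independent. A covariant random operator has
non-random spectral components: whether a spectral subspace charges a rational interval is a
translation-invariant event, and it is measurable because the moments of the spectral measures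
are matrix elements of powers of the operator.

Almost surely every finite pattern of open and closed bonds occurs at infinitely many places. On
a large fully open box a truncated plane wave of phase `θ` is an approximate eigenvector of
energy `2d - 2d cos θ`, the error living on the boundary shell; these energies sweep out
`[0, 4d]`, which also contains the spectrum by the quadratic form bounds.

Below the critical probability all clusters are finite, so the operator is block diagonal with
finite blocks and hence pure point. Its eigenvalues are then the energies of finitely supported
eigenvectors over all configurations: each of these is seen by almost every configuration at
infinitely many translates, which gives at once non-randomness and infinite multiplicity. The
eigenvalues of a pure point operator are dense in its spectrum.
-/

open Filter Topology ProbabilityTheory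

namespace PercLap

section SpectralCalculus

open scoped BoundedContinuousFunction ComplexConjugate
open BoundedContinuousFunction (toLp toLp_denseRange coeFn_toLp)

variable {H : Type*} [NormedAddCommGroup H] [InnerProductSpace ℂ H] [CompleteSpace H]

theorem spectralMeasure_compl_spectrum (A : H →L[ℂ] H) (φ : H) :
    spectralMeasure A φ (spectrum ℝ A)ᶜ = 0 := by
  have hc : IsClosed (spectrum ℝ A) := spectrum.isClosed A
  rw [hc.isOpen_compl.measure_eq_iSup_isCompact]
  simp only [ENNReal.iSup_eq_zero]
  intro K hK hKc
  obtain ⟨f, hf1, hf0, hfc, hf01⟩ := exists_continuous_one_zero_of_isCompact hKc hc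
    (Set.disjoint_left.2 fun x hx => hK hx)
  let g : C_c(ℝ, ℝ) := ⟨f, hfc⟩
  have hzero : ∫ x, g x ∂(spectralMeasure A φ) = 0 := by
    rw [integral_spectralMeasure,
      cfc_congr (f := (g : ℝ → ℝ)) (g := fun _ => (0 : ℝ)) (fun x hx => hf0 hx)]
    simp
  have hint := integrable_Cc (spectralMeasure A φ) g
  have hae := (integral_eq_zero_iff_of_nonneg (fun x => (hf01 x).1) hint).1 hzero
  refine measure_mono_null (fun x hx => ?_) hae
  change ¬ f x = 0
  simp [hf1 hx]

theorem exists_Cc_eqOn_spectrum (A : H →L[ℂ] H) {f : ℝ → ℝ} (hf : Continuous f) :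
    ∃ g : C_c(ℝ, ℝ), Set.EqOn f g (spectrum ℝ A) := by
  obtain ⟨b, hb1, -, hbc, -⟩ := exists_continuous_one_zero_of_isCompact
    (ContinuousFunctionalCalculus.isCompact_spectrum (R := ℝ) A) isClosed_empty
    (Set.disjoint_empty _)
  refine ⟨⟨⟨fun x => f x * b x, by fun_prop⟩, hbc.mul_left⟩, fun x hx => ?_⟩
  change f x = f x * b x
  simp [hb1 hx]

theorem ae_mem_spectrum (A : H →L[ℂ] H) (φ : H) :
    ∀ᵐ x ∂(spectralMeasure A φ), x ∈ spectrum ℝ A :=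
  mem_ae_iff.2 (spectralMeasure_compl_spectrum A φ)

theorem integrable_spectralMeasure (A : H →L[ℂ] H) (φ : H) {f : ℝ → ℝ} (hf : Continuous f) :
    Integrable f (spectralMeasure A φ) := by
  obtain ⟨g, hg⟩ := exists_Cc_eqOn_spectrum A hf
  refine (integrable_Cc _ g).congr ?_
  filter_upwards [ae_mem_spectrum A φ] with x hx using (hg hx).symm

theorem integral_spectralMeasure_of_continuous (A : H →L[ℂ] H) (φ : H) {f : ℝ → ℝ}
    (hf : Continuous f) :
    ∫ x, f x ∂(spectralMeasure A φ) = (⟪φ, cfc f A φ⟫_ℂ).re := by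
  obtain ⟨g, hg⟩ := exists_Cc_eqOn_spectrum A hf
  rw [cfc_congr hg, ← integral_spectralMeasure]
  refine integral_congr_ae ?_
  filter_upwards [ae_mem_spectrum A φ] with x hx using hg hx

instance (A : H →L[ℂ] H) (φ : H) : IsFiniteMeasure (spectralMeasure A φ) :=
  (integrable_const_iff_isFiniteMeasure one_ne_zero).1
    (integrable_spectralMeasure A φ (continuous_const (y := (1 : ℝ))))

theorem inner_cfc_left (A : H →L[ℂ] H) (f : ℝ → ℝ) (φ ψ : H) :
    ⟪cfc f A φ, ψ⟫_ℂ = ⟪φ, cfc f A ψ⟫_ℂ := by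
  have h : IsSelfAdjoint (cfc f A) := cfc_predicate f A
  rw [← ContinuousLinearMap.adjoint_inner_right, ← ContinuousLinearMap.star_eq_adjoint, h.star_eq]

theorem norm_sq_cfc_apply (A : H →L[ℂ] H) (φ : H) {f : ℝ → ℝ} (hf : Continuous f) :
    ‖cfc f A φ‖ ^ 2 = ∫ x, f x ^ 2 ∂(spectralMeasure A φ) := by
  have hsq : cfc (fun x => f x ^ 2) A = cfc f A * cfc f A := by
    rw [← cfc_mul f f A hf.continuousOn hf.continuousOn]
    exact cfc_congr fun x _ => sq (f x)
  rw [integral_spectralMeasure_of_continuous A φ (show Continuous fun x => f x ^ 2 by fun_prop),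
    hsq, mul_apply_eq_comp, ← inner_cfc_left, inner_self_eq_norm_sq_to_K]
  norm_cast

theorem spectralMeasure_cfc_apply (A : H →L[ℂ] H) (φ : H) {f : ℝ → ℝ} (hf : Continuous f) :
    spectralMeasure A (cfc f A φ) =
      (spectralMeasure A φ).withDensity fun x => ENNReal.ofReal (f x ^ 2) := by
  have : IsLocallyFiniteMeasure
      ((spectralMeasure A φ).withDensity fun x => ENNReal.ofReal (f x ^ 2)) :=
    IsLocallyFiniteMeasure.withDensity_ofReal (by fun_prop)
  refine Measure.ext_of_integral_eq_on_compactlySupported fun g => ?_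
  have hg := g.continuous
  have hmul : cfc (fun x => f x * (g x * f x)) A =
      cfc f A * (cfc (g : ℝ → ℝ) A * cfc f A) := by
    rw [cfc_mul f (fun x => g x * f x) A hf.continuousOn (by fun_prop),
      cfc_mul (g : ℝ → ℝ) f A hg.continuousOn hf.continuousOn]
  rw [integral_spectralMeasure, integral_withDensity_eq_integral_toReal_smul (by fun_prop)
    (by simp), inner_cfc_left]
  have hintegral := integral_spectralMeasure_of_continuous A φ
    (show Continuous fun x => f x * (g x * f x) by fun_prop)
  rw [hmul] at hintegral
  simp only [mul_apply_eq_comp] at hintegral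
  rw [← hintegral]
  refine integral_congr_ae (.of_forall fun x => ?_)
  simp only [ENNReal.toReal_ofReal (sq_nonneg (f x)), smul_eq_mul]
  ring

variable {A : H →L[ℂ] H}

theorem cfc_one_apply (hA : IsSelfAdjoint A) (φ : H) : cfc (fun _ : ℝ => (1 : ℝ)) A φ = φ := by
  rw [cfc_const_one ℝ A]
  rfl

theorem norm_sq_eq_spectralMeasure (hA : IsSelfAdjoint A) (φ : H) :
    ‖φ‖ ^ 2 = (spectralMeasure A φ).real Set.univ := by
  have h := norm_sq_cfc_apply A φ (continuous_const (y := (1 : ℝ)))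
  rw [cfc_one_apply hA] at h
  simpa using h

theorem spectralMeasure_eq_zero_iff (hA : IsSelfAdjoint A) (φ : H) :
    spectralMeasure A φ = 0 ↔ φ = 0 := by
  refine ⟨fun h => ?_, fun h => h ▸ spectralMeasure_zero A⟩
  have := norm_sq_eq_spectralMeasure hA φ
  simpa [h] using this

theorem cfc_apply_congr_ae (A : H →L[ℂ] H) (φ : H) {f g : ℝ → ℝ} (hf : Continuous f)
    (hg : Continuous g) (h : f =ᵐ[spectralMeasure A φ] g) : cfc f A φ = cfc g A φ := by
  rw [← sub_eq_zero, ← sub_apply, ← cfc_sub f g A hf.continuousOn hg.continuousOn, ← norm_eq_zero,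
    ← sq_eq_zero_iff, norm_sq_cfc_apply A φ (by fun_prop)]
  refine integral_eq_zero_of_ae ?_
  filter_upwards [h] with x hx
  simp [hx]

theorem norm_ofReal_sub_sq (x : ℝ) (E : ℂ) :
    ‖(x : ℂ) - E‖ ^ 2 = x ^ 2 - 2 * E.re * x + (E.re ^ 2 + E.im ^ 2) := by
  rw [← Complex.normSq_eq_norm_sq, Complex.normSq_apply, Complex.sub_re, Complex.sub_im,
    Complex.ofReal_re, Complex.ofReal_im]
  ring

theorem cfc_norm_sub_sq (hA : IsSelfAdjoint A) (E : ℂ) :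
    cfc (fun x : ℝ => ‖(x : ℂ) - E‖ ^ 2) A = (A - E • 1) * (A - conj E • 1) := by
  have hpoly (a b : ℝ) :
      cfc (fun x : ℝ => x ^ 2 - a * x + b) A = A ^ 2 - (a : ℂ) • A + (b : ℂ) • 1 := by
    have h := cfc_polynomial (.X ^ 2 - .C a * .X + .C b : Polynomial ℝ) A
    simpa only [Polynomial.eval_add, Polynomial.eval_sub, Polynomial.eval_pow, Polynomial.eval_mul,
      Polynomial.eval_X, Polynomial.eval_C, map_add, map_sub, map_mul, map_pow, Polynomial.aeval_X,
      Polynomial.aeval_C, Algebra.algebraMap_eq_smul_one, smul_mul_assoc, one_mul,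
      Complex.coe_smul] using h
  have hsum : ((2 * E.re : ℝ) : ℂ) = E + conj E := (Complex.add_conj E).symm
  have hprod : ((E.re ^ 2 + E.im ^ 2 : ℝ) : ℂ) = E * conj E := by
    rw [Complex.mul_conj, Complex.normSq_apply, sq, sq]
  simp only [norm_ofReal_sub_sq]
  rw [hpoly, hsum, hprod]
  simp only [sub_mul, mul_sub, smul_mul_assoc, mul_smul_comm, one_mul, mul_one, sq]
  module

theorem norm_sq_apply_sub (hA : IsSelfAdjoint A) (E : ℂ) (φ : H) :
    ‖A φ - E • φ‖ ^ 2 = ∫ x : ℝ, ‖(x : ℂ) - E‖ ^ 2 ∂(spectralMeasure A φ) := by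
  have hadj : (A - E • 1).adjoint = A - conj E • 1 := by
    rw [← ContinuousLinearMap.star_eq_adjoint, star_sub, hA.star_eq, star_smul, star_one]
    rfl
  have hfun : (fun x : ℝ => ‖(x : ℂ) - E‖ ^ 2) = fun x : ℝ => ‖(x : ℂ) - conj E‖ ^ 2 := by
    ext x
    simp [norm_ofReal_sub_sq]
  have h := (A - E • 1).apply_norm_sq_eq_inner_adjoint_right φ
  rw [integral_spectralMeasure_of_continuous A φ (by fun_prop), hfun, cfc_norm_sub_sq hA,
    Complex.conj_conj, ← hadj]
  exact h

theorem enorm_cfc_apply (A : H →L[ℂ] H) (φ : H) {f : ℝ → ℝ} (hf : Continuous f) :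
    ‖cfc f A φ‖ₑ = eLpNorm f 2 (spectralMeasure A φ) := by
  have hf2 : MemLp f 2 (spectralMeasure A φ) :=
    (memLp_two_iff_integrable_sq hf.aestronglyMeasurable).2
      (integrable_spectralMeasure A φ (hf.pow 2))
  rw [← ofReal_norm, hf2.eLpNorm_eq_integral_rpow_norm two_ne_zero ENNReal.ofNat_ne_top]
  simp [← norm_sq_cfc_apply A φ hf, ← Real.sqrt_eq_rpow, -one_div, ← one_div]

/-- The real linear map `g ↦ g(A) φ` on bounded continuous functions. -/
noncomputable def boundedCfcApply (A : H →L[ℂ] H) (φ : H) :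
    (ℝ →ᵇ ℝ) →ₗ[ℝ] H where
  toFun g := cfc g A φ
  map_add' f g := by
    rw [BoundedContinuousFunction.coe_add, Pi.add_def, cfc_add A f g, add_apply]
  map_smul' c g := by
    rw [BoundedContinuousFunction.coe_smul, cfc_smul c g A]
    rfl

/-- The cyclic representation `L²(μ_φ) → H` of `φ`: the isometry that sends a bounded continuous
function `g` to `g(A) φ`. It is only real linear, since it is built from the continuous functional
calculus of real functions. -/
noncomputable def cyclicMap (A : H →L[ℂ] H) (φ : H) : Lp ℝ 2 (spectralMeasure A φ) →L[ℝ] H :=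
  (boundedCfcApply A φ).extendOfNorm
    (toLp 2 (spectralMeasure A φ) ℝ).toLinearMap

theorem cyclicMap_toLp (A : H →L[ℂ] H) (φ : H) (g : ℝ →ᵇ ℝ) :
    cyclicMap A φ (toLp 2 (spectralMeasure A φ) ℝ g) = cfc g A φ := by
  have hnorm (g : ℝ →ᵇ ℝ) :
      ‖boundedCfcApply A φ g‖ ≤ 1 * ‖(toLp 2 (spectralMeasure A φ) ℝ).toLinearMap g‖ := by
    change ‖cfc g A φ‖ ≤ 1 * ‖toLp 2 (spectralMeasure A φ) ℝ g‖
    rw [one_mul, Lp.norm_def, eLpNorm_congr_ae (coeFn_toLp _ _ ℝ g),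
      ← enorm_cfc_apply A φ g.continuous, toReal_enorm]
  exact LinearMap.extendOfNorm_eq (e := (toLp 2 (spectralMeasure A φ) ℝ).toLinearMap)
    (toLp_denseRange ℝ (spectralMeasure A φ) ℝ ENNReal.ofNat_ne_top) ⟨1, hnorm⟩ g

theorem integral_spectralMeasure_cyclicMap (A : H →L[ℂ] H) (φ : H)
    (f : Lp ℝ 2 (spectralMeasure A φ)) (g : C_c(ℝ, ℝ)) :
    ∫ x, g x ∂(spectralMeasure A (cyclicMap A φ f)) =
      ∫ x, f x ^ 2 * g x ∂(spectralMeasure A φ) := by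
  have hg : MemLp g ∞ (spectralMeasure A φ) := by
    obtain ⟨C, hC⟩ := g.hasCompactSupport.exists_bound_of_continuous g.continuous
    exact memLp_top_of_bound g.continuous.aestronglyMeasurable C (.of_forall hC)
  let M : Lp ℝ 2 (spectralMeasure A φ) →L[ℝ] Lp ℝ 2 (spectralMeasure A φ) :=
    (ContinuousLinearMap.lsmul ℝ ℝ).holderL (spectralMeasure A φ) ∞ 2 2 hg.toLp
  have hM (u : Lp ℝ 2 (spectralMeasure A φ)) :
      ⟪u, M u⟫_ℝ = ∫ x, u x ^ 2 * g x ∂(spectralMeasure A φ) := by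
    rw [L2.inner_def]
    refine integral_congr_ae ?_
    filter_upwards [(ContinuousLinearMap.lsmul ℝ ℝ).coeFn_holder (r := 2) hg.toLp u, hg.coeFn_toLp]
      with x hx hgx
    change ⟪u x, (ContinuousLinearMap.lsmul ℝ ℝ).holder 2 hg.toLp u x⟫_ℝ = _
    rw [hx, hgx, ContinuousLinearMap.lsmul_apply, smul_eq_mul, real_inner_eq_re_inner,
      RCLike.inner_apply, RCLike.conj_to_real, RCLike.re_to_real]
    ring
  rw [← hM, integral_spectralMeasure]
  refine (toLp_denseRange (p := 2) ℝ (spectralMeasure A φ) ℝ ENNReal.ofNat_ne_top).induction_on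
    (p := fun f => (⟪cyclicMap A φ f, cfc g A (cyclicMap A φ f)⟫_ℂ).re = ⟪f, M f⟫_ℝ) f
    (isClosed_eq (by fun_prop) (by fun_prop)) fun b => ?_
  rw [hM, cyclicMap_toLp, ← integral_spectralMeasure, spectralMeasure_cfc_apply A φ b.continuous,
    integral_withDensity_eq_integral_toReal_smul (by fun_prop) (by simp)]
  refine integral_congr_ae ?_
  filter_upwards [coeFn_toLp 2 (spectralMeasure A φ) ℝ b] with x hx
  rw [hx, ENNReal.toReal_ofReal (sq_nonneg _), smul_eq_mul]

theorem spectralMeasure_cyclicMap (A : H →L[ℂ] H) (φ : H) (f : Lp ℝ 2 (spectralMeasure A φ)) :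
    spectralMeasure A (cyclicMap A φ f) =
      (spectralMeasure A φ).withDensity fun x => ENNReal.ofReal (f x ^ 2) := by
  have := isFiniteMeasure_withDensity_ofReal (Lp.memLp f).integrable_sq.2
  refine Measure.ext_of_integral_eq_on_compactlySupported fun g => ?_
  rw [integral_spectralMeasure_cyclicMap,
    integral_withDensity_eq_integral_toReal_smul₀
      ((Lp.aestronglyMeasurable f).aemeasurable.pow_const 2).ennreal_ofReal (by simp)]
  simp only [ENNReal.toReal_ofReal (sq_nonneg _), smul_eq_mul]

theorem exists_spectralMeasure_eq_restrict (A : H →L[ℂ] H) (φ : H) {S : Set ℝ}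
    (hS : MeasurableSet S) :
    ∃ ψ, spectralMeasure A ψ = (spectralMeasure A φ).restrict S := by
  refine ⟨cyclicMap A φ (indicatorConstLp 2 hS (measure_ne_top _ _) 1), ?_⟩
  rw [spectralMeasure_cyclicMap, ← withDensity_indicator_one hS]
  refine withDensity_congr_ae ?_
  filter_upwards [indicatorConstLp_coeFn (p := 2) (hs := hS)
    (hμs := measure_ne_top (spectralMeasure A φ) S) (c := (1 : ℝ))] with x hx
  by_cases h : x ∈ S <;> simp [hx, h]

theorem exists_continuous_cfc_apply_near (hA : IsSelfAdjoint A) {φ ψ : H} {S : Set ℝ}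
    (hS : MeasurableSet S) (hφ : spectralMeasure A φ S = 0) (hψ : spectralMeasure A ψ Sᶜ = 0)
    {ε : ℝ} (hε : 0 < ε) :
    ∃ f : ℝ → ℝ, Continuous f ∧ ‖cfc f A φ‖ ≤ ε ∧ ‖ψ - cfc f A ψ‖ ≤ ε := by
  have hind : MemLp (S.indicator (1 : ℝ → ℝ)) 2 (spectralMeasure A φ + spectralMeasure A ψ) :=
    (memLp_const 1).indicator hS
  obtain ⟨f, hf, -⟩ := hind.exists_boundedContinuous_eLpNorm_sub_le ENNReal.ofNat_ne_top
    (ENNReal.ofReal_pos.2 hε).ne'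
  refine ⟨f, f.continuous, (ENNReal.ofReal_le_ofReal_iff hε.le).1 (le_trans ?_ hf),
    (ENNReal.ofReal_le_ofReal_iff hε.le).1 (le_trans ?_ hf)⟩
  · rw [ofReal_norm, enorm_cfc_apply A φ f.continuous, ← eLpNorm_neg]
    refine (eLpNorm_congr_ae ?_).trans_le (eLpNorm_mono_measure _ (Measure.le_add_right le_rfl))
    filter_upwards [measure_eq_zero_iff_ae_notMem.1 hφ] with x hx
    simp [hx]
  · have h : ψ - cfc f A ψ = cfc (fun x => 1 - f x) A ψ := by
      rw [cfc_sub (fun _ => (1 : ℝ)) f A, sub_apply, cfc_one_apply hA]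
    rw [ofReal_norm, h, enorm_cfc_apply A ψ (by fun_prop)]
    refine (eLpNorm_congr_ae ?_).trans_le (eLpNorm_mono_measure _ (Measure.le_add_left le_rfl))
    filter_upwards [mem_ae_iff.2 hψ] with x hx
    simp [hx]

theorem inner_eq_zero_of_mutuallySingular (hA : IsSelfAdjoint A) {φ ψ : H}
    (h : (spectralMeasure A φ).MutuallySingular (spectralMeasure A ψ)) : ⟪φ, ψ⟫_ℂ = 0 := by
  obtain ⟨S, hS, hφ, hψ⟩ := h
  have hbound : ∀ ε > 0, ‖⟪φ, ψ⟫_ℂ‖ ≤ ε * (‖φ‖ + ‖ψ‖) := fun ε hε => by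
    obtain ⟨f, -, hfφ, hfψ⟩ := exists_continuous_cfc_apply_near hA hS hφ hψ hε
    calc ‖⟪φ, ψ⟫_ℂ‖ = ‖⟪φ, ψ - cfc f A ψ⟫_ℂ + ⟪cfc f A φ, ψ⟫_ℂ‖ := by
          rw [inner_cfc_left, inner_sub_right, sub_add_cancel]
      _ ≤ ‖φ‖ * ‖ψ - cfc f A ψ‖ + ‖cfc f A φ‖ * ‖ψ‖ :=
          norm_add_le_of_le (norm_inner_le_norm _ _) (norm_inner_le_norm _ _)
      _ ≤ ‖φ‖ * ε + ε * ‖ψ‖ := by gcongr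
      _ = ε * (‖φ‖ + ‖ψ‖) := by ring
  have hlim : Tendsto (fun ε => ε * (‖φ‖ + ‖ψ‖)) (𝓝[>] 0) (𝓝 0) :=
    ((continuous_mul_const _).tendsto' 0 0 (zero_mul _)).mono_left nhdsWithin_le_nhds
  exact norm_le_zero_iff.1 (ge_of_tendsto hlim (eventually_mem_nhdsWithin.mono hbound))

end SpectralCalculus

section SpectralComponents

open scoped ComplexConjugate

section Spectrum

variable {V : Type*} [NormedAddCommGroup V] [NormedSpace ℂ V] {T : V →L[ℂ] V} {E : ℂ}

theorem mem_spectrum_of_approx_eigenvector (h : ∀ ε > 0, ∃ v ≠ 0, ‖T v - E • v‖ ≤ ε * ‖v‖) :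
    E ∈ spectrum ℂ T := by
  rw [spectrum.mem_iff]
  intro hu
  obtain ⟨R, -, hR⟩ := isUnit_iff_exists.1 hu
  obtain ⟨v, hv0, hv⟩ := h (1 / (‖R‖ + 1)) (by positivity)
  have hRv : R (E • v - T v) = v := DFunLike.congr_fun hR v
  have hle : ‖v‖ ≤ ‖R‖ / (‖R‖ + 1) * ‖v‖ := by
    calc ‖v‖ = ‖R (E • v - T v)‖ := by rw [hRv]
      _ ≤ ‖R‖ * ‖E • v - T v‖ := R.le_opNorm _
      _ ≤ ‖R‖ * (1 / (‖R‖ + 1) * ‖v‖) := by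
        rw [norm_sub_rev]
        gcongr
      _ = ‖R‖ / (‖R‖ + 1) * ‖v‖ := by ring
  have hlt : ‖R‖ / (‖R‖ + 1) < 1 := (div_lt_one (by positivity)).2 (lt_add_one _)
  exact absurd hle (not_le.2 (mul_lt_of_lt_one_left (norm_pos_iff.2 hv0) hlt))

theorem notMem_spectrum_of_inverse {R : V →L[ℂ] V} (hr : ∀ v, T (R v) - E • R v = v)
    (hl : ∀ v, R (T v - E • v) = v) : E ∉ spectrum ℂ T := by
  have h : E ∈ resolventSet ℂ T :=
    spectrum.mem_resolventSet_of_left_right_inverse (b := -R) (c := -R)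
      (ContinuousLinearMap.ext fun v => by
        change E • -R v - T (-R v) = v
        rw [map_neg, smul_neg, sub_neg_eq_add, neg_add_eq_sub, hr])
      (ContinuousLinearMap.ext fun v => by
        change -R (E • v - T v) = v
        rw [← map_neg, neg_sub, hl])
  exact fun hE => hE h

end Spectrum

variable {H : Type*} [NormedAddCommGroup H] [InnerProductSpace ℂ H] [CompleteSpace H]
  {A : H →L[ℂ] H}

theorem mem_spectralSubspace_of_absolutelyContinuous {κ : SpectralType} {φ ψ : H}
    (hφ : φ ∈ spectralSubspace A κ) (h : spectralMeasure A ψ ≪ spectralMeasure A φ) :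
    ψ ∈ spectralSubspace A κ :=
  SpectralType.Holds.mono hφ h

theorem measurableSet_norm_sub_lt (E : ℂ) (ε : ℝ) :
    MeasurableSet {x : ℝ | ‖(x : ℂ) - E‖ < ε} :=
  (isOpen_lt (by fun_prop) continuous_const).measurableSet

theorem ne_zero_of_spectralMeasure_eq_restrict {φ ψ : H} {S : Set ℝ}
    (hψ : spectralMeasure A ψ = (spectralMeasure A φ).restrict S) (h : spectralMeasure A φ S ≠ 0) :
    ψ ≠ 0 := by
  intro h0
  rw [h0, spectralMeasure_zero] at hψ
  exact h (Measure.restrict_eq_zero.1 hψ.symm)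

theorem absolutelyContinuous_of_eq_restrict {μ ν : Measure ℝ} {S : Set ℝ}
    (h : ν = μ.restrict S) : ν ≪ μ :=
  h ▸ Measure.absolutelyContinuous_restrict

theorem exists_approx_eigenvector (hA : IsSelfAdjoint A) {E : ℂ} {ε : ℝ} {φ : H}
    (h : spectralMeasure A φ {x | ‖(x : ℂ) - E‖ < ε} ≠ 0) :
    ∃ ψ ≠ 0, spectralMeasure A ψ ≪ spectralMeasure A φ ∧ ‖A ψ - E • ψ‖ ≤ ε * ‖ψ‖ := by
  have hS := measurableSet_norm_sub_lt E ε
  obtain ⟨ψ, hψ⟩ := exists_spectralMeasure_eq_restrict A φ hS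
  obtain ⟨x, hx⟩ := nonempty_of_measure_ne_zero h
  have hε : 0 < ε := (norm_nonneg _).trans_lt hx
  refine ⟨ψ, ne_zero_of_spectralMeasure_eq_restrict hψ h,
    absolutelyContinuous_of_eq_restrict hψ, le_of_sq_le_sq ?_ (by positivity)⟩
  calc ‖A ψ - E • ψ‖ ^ 2 = ∫ x : ℝ, ‖(x : ℂ) - E‖ ^ 2 ∂(spectralMeasure A ψ) :=
        norm_sq_apply_sub hA E ψ
    _ ≤ ∫ _, ε ^ 2 ∂(spectralMeasure A ψ) := by
        refine integral_mono_of_nonneg (.of_forall fun x => by positivity) (integrable_const _) ?_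
        rw [hψ]
        filter_upwards [ae_restrict_mem hS] with x (hx : ‖(x : ℂ) - E‖ < ε)
        gcongr
    _ = (ε * ‖ψ‖) ^ 2 := by
        rw [integral_const, ← norm_sq_eq_spectralMeasure hA, smul_eq_mul, mul_pow, mul_comm]

theorem cfc_apply_mem_spectralSubspace {κ : SpectralType} {φ : H} (hφ : φ ∈ spectralSubspace A κ)
    {f : ℝ → ℝ} (hf : Continuous f) : cfc f A φ ∈ spectralSubspace A κ := by
  refine mem_spectralSubspace_of_absolutelyContinuous hφ ?_
  rw [spectralMeasure_cfc_apply A φ hf]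
  exact withDensity_absolutelyContinuous _ _

/-- The function `1 / |x - E|²`, cut off inside the ball of radius `ε` around `E` so that it is
continuous on the whole line. -/
noncomputable def cutoffInvSq (E : ℂ) (ε x : ℝ) : ℝ := (max (‖(x : ℂ) - E‖ ^ 2) (ε ^ 2))⁻¹

/-- The bounded function `(x - conj E) / max (|x - E|²) (ε²)` of `A`. It inverts `A - E` on the
vectors whose spectral measure does not charge the ball of radius `ε` around `E`. -/
noncomputable def localResolvent (A : H →L[ℂ] H) (E : ℂ) (ε : ℝ) : H →L[ℂ] H :=
  (A - conj E • 1) * cfc (cutoffInvSq E ε) A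

section LocalResolvent

variable {ε : ℝ}

theorem continuous_cutoffInvSq (E : ℂ) (hε : 0 < ε) : Continuous (cutoffInvSq E ε) := by
  have hpos (x : ℝ) : 0 < max (‖(x : ℂ) - E‖ ^ 2) (ε ^ 2) := lt_max_of_lt_right (by positivity)
  exact Continuous.inv₀ (by fun_prop) fun x => (hpos x).ne'

theorem mapsTo_localResolvent (κ : SpectralType) (E : ℂ) (hε : 0 < ε) :
    Set.MapsTo (localResolvent A E ε) (spectralSubspace A κ) (spectralSubspace A κ) := by
  intro φ hφ
  have h := cfc_apply_mem_spectralSubspace hφ (continuous_cutoffInvSq E hε)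
  exact sub_mem (mapsTo_spectralSubspace A κ h) (Submodule.smul_mem _ _ h)

theorem commute_localResolvent (hA : IsSelfAdjoint A) (E z : ℂ) (ε : ℝ) :
    Commute (localResolvent A E ε) (A - z • 1) := by
  have hsmul (B : H →L[ℂ] H) (c : ℂ) : Commute B (c • 1) := (Commute.one_right B).smul_right c
  have hcfc : Commute (cfc (cutoffInvSq E ε) A) A := by
    simpa only [cfc_id' ℝ A] using cfc_commute_cfc (cutoffInvSq E ε) (fun x : ℝ => x) A
  exact (((Commute.refl A).sub_left (hsmul A _).symm).sub_right (hsmul _ _)).mul_left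
    (hcfc.sub_right (hsmul _ _))

theorem sub_mul_localResolvent (hA : IsSelfAdjoint A) (E : ℂ) (hε : 0 < ε) :
    (A - E • 1) * localResolvent A E ε =
      cfc (fun x : ℝ => ‖(x : ℂ) - E‖ ^ 2 * cutoffInvSq E ε x) A := by
  rw [localResolvent, ← mul_assoc, ← cfc_norm_sub_sq hA,
    cfc_mul _ _ A (by fun_prop) (continuous_cutoffInvSq E hε).continuousOn]

theorem apply_localResolvent_sub (hA : IsSelfAdjoint A) {E : ℂ} (hε : 0 < ε) {φ : H}
    (hφ : spectralMeasure A φ {x | ‖(x : ℂ) - E‖ < ε} = 0) :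
    A (localResolvent A E ε φ) - E • localResolvent A E ε φ = φ := by
  change ((A - E • 1) * localResolvent A E ε) φ = φ
  rw [sub_mul_localResolvent hA E hε]
  refine (cfc_apply_congr_ae A φ ?_ continuous_const ?_).trans (cfc_one_apply hA φ)
  · exact Continuous.mul (by fun_prop) (continuous_cutoffInvSq E hε)
  · filter_upwards [measure_eq_zero_iff_ae_notMem.1 hφ] with x hx
    have hle : ε ≤ ‖(x : ℂ) - E‖ := not_lt.1 hx
    have hpos : 0 < ‖(x : ℂ) - E‖ := hε.trans_le hle
    rw [cutoffInvSq, max_eq_left (by gcongr), mul_inv_cancel₀ (by positivity)]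

theorem localResolvent_apply_sub (hA : IsSelfAdjoint A) {E : ℂ} (hε : 0 < ε) {φ : H}
    (hφ : spectralMeasure A φ {x | ‖(x : ℂ) - E‖ < ε} = 0) :
    localResolvent A E ε (A φ - E • φ) = φ :=
  (DFunLike.congr_fun (commute_localResolvent hA E E ε).eq φ).trans
    (apply_localResolvent_sub hA hε hφ)

end LocalResolvent

theorem mem_spectralComponent_iff (hA : IsSelfAdjoint A) (κ : SpectralType) (E : ℂ) :
    E ∈ spectralComponent A κ ↔ ∀ ε > 0, ∃ φ ∈ spectralSubspace A κ,
      spectralMeasure A φ {x | ‖(x : ℂ) - E‖ < ε} ≠ 0 := by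
  constructor
  · intro hE
    by_contra! hcon
    obtain ⟨ε, hε, h0⟩ := hcon
    refine notMem_spectrum_of_inverse
      (R := (localResolvent A E ε).restrict (mapsTo_localResolvent κ E hε)) ?_ ?_ hE
    · exact fun φ => Subtype.ext (apply_localResolvent_sub hA hε (h0 φ φ.2))
    · exact fun φ => Subtype.ext (localResolvent_apply_sub hA hε (h0 φ φ.2))
  · intro h
    refine mem_spectrum_of_approx_eigenvector fun ε hε => ?_
    obtain ⟨φ, hφ, hne⟩ := h ε hε
    obtain ⟨ψ, hψ0, hψ, hle⟩ := exists_approx_eigenvector hA hne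
    exact ⟨⟨ψ, mem_spectralSubspace_of_absolutelyContinuous hφ hψ⟩,
      fun h => hψ0 (congrArg Subtype.val h), hle⟩

theorem exists_spectralMeasure_ne_zero_of_mem_spectrum (hA : IsSelfAdjoint A) {E : ℂ}
    (hE : E ∈ spectrum ℂ A) {ε : ℝ} (hε : 0 < ε) :
    ∃ φ, spectralMeasure A φ {x | ‖(x : ℂ) - E‖ < ε} ≠ 0 := by
  by_contra! h0
  exact notMem_spectrum_of_inverse (fun φ => apply_localResolvent_sub hA hε (h0 φ))
    (fun φ => localResolvent_apply_sub hA hε (h0 φ)) hE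

theorem spectralComponent_subset_spectrum (hA : IsSelfAdjoint A) (κ : SpectralType) :
    spectralComponent A κ ⊆ spectrum ℂ A := fun E hE =>
  mem_spectrum_of_approx_eigenvector fun ε hε => by
    obtain ⟨φ, -, hne⟩ := (mem_spectralComponent_iff hA κ E).1 hE ε hε
    obtain ⟨ψ, hψ0, -, hle⟩ := exists_approx_eigenvector hA hne
    exact ⟨ψ, hψ0, hle⟩

theorem spectralComponent_eq_spectrum (hA : IsSelfAdjoint A) {κ : SpectralType}
    (h : spectralSubspace A κ = ⊤) : spectralComponent A κ = spectrum ℂ A := by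
  refine (spectralComponent_subset_spectrum hA κ).antisymm fun E hE => ?_
  refine (mem_spectralComponent_iff hA κ E).2 fun ε hε => ?_
  obtain ⟨φ, hφ⟩ := exists_spectralMeasure_ne_zero_of_mem_spectrum hA hE hε
  exact ⟨φ, h ▸ Submodule.mem_top, hφ⟩

theorem exists_eigenvector_of_atom (hA : IsSelfAdjoint A) {φ : H} {x : ℝ}
    (h : spectralMeasure A φ {x} ≠ 0) : ∃ ψ ≠ 0, A ψ = (x : ℂ) • ψ := by
  obtain ⟨ψ, hψ⟩ := exists_spectralMeasure_eq_restrict A φ (measurableSet_singleton x)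
  refine ⟨ψ, ne_zero_of_spectralMeasure_eq_restrict hψ h, ?_⟩
  rw [← sub_eq_zero, ← norm_eq_zero, ← sq_eq_zero_iff, norm_sq_apply_sub hA, hψ]
  refine integral_eq_zero_of_ae ?_
  filter_upwards [ae_restrict_mem (measurableSet_singleton x)] with y (hy : y = x)
  simp [hy]

/-- The set of atoms of a measure. -/
def atoms (μ : Measure ℝ) : Set ℝ := {x | μ {x} ≠ 0}

theorem countable_atoms (μ : Measure ℝ) [SFinite μ] : (atoms μ).Countable := by
  refine (Measure.countable_meas_pos_of_disjoint_iUnion (μ := μ) (As := fun x : ℝ => {x})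
    (fun x => measurableSet_singleton x) fun x y hxy => ?_).mono fun x hx => pos_iff_ne_zero.2 hx
  simpa [Function.onFun] using hxy

/-- A set that carries exactly the part of `μ` of the given type. Here `N` is meant to be a
Lebesgue-null set off which `μ` is absolutely continuous. -/
def carrier (μ : Measure ℝ) (N : Set ℝ) : SpectralType → Set ℝ
  | .pp => atoms μ
  | .sc => N \ atoms μ
  | .ac => Nᶜ

section Carrier

variable {μ : Measure ℝ} {N : Set ℝ}

theorem measurableSet_carrier [SFinite μ] (hN : MeasurableSet N) (κ : SpectralType) :
    MeasurableSet (carrier μ N κ) := by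
  cases κ
  · exact (countable_atoms μ).measurableSet
  · exact hN.diff (countable_atoms μ).measurableSet
  · exact hN.compl

theorem measure_eq_zero_of_countable_of_disjoint_atoms {S : Set ℝ} (hS : S.Countable)
    (h : Disjoint S (atoms μ)) : μ S = 0 := by
  rw [← Set.biUnion_of_singleton S, measure_biUnion_null_iff hS]
  exact fun x hx => not_not.1 fun hne => Set.disjoint_left.1 h hx hne

theorem atoms_eq_empty_iff : atoms μ = ∅ ↔ ∀ x, μ {x} = 0 := by
  simp [atoms, Set.eq_empty_iff_forall_notMem]

theorem holds_restrict_carrier [SFinite μ] (hN : MeasurableSet N) (hN0 : volume N = 0)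
    (hac : μ.restrict Nᶜ ≪ volume) (κ : SpectralType) : κ.Holds (μ.restrict (carrier μ N κ)) := by
  cases κ
  · refine ⟨atoms μ, countable_atoms μ, ?_⟩
    rw [Measure.restrict_apply (countable_atoms μ).measurableSet.compl]
    simp [carrier]
  · refine ⟨fun x => ?_, Nᶜ, hN.compl, ?_, ?_⟩
    · rw [Measure.restrict_apply (measurableSet_singleton x)]
      by_cases hx : x ∈ carrier μ N .sc
      · exact measure_mono_null Set.inter_subset_left (not_not.1 hx.2)
      · rw [Set.singleton_inter_eq_empty.2 hx, measure_empty]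
    · rw [Measure.restrict_apply hN.compl]
      exact measure_mono_null (fun x hx => hx.1 hx.2.1) measure_empty
    · rw [compl_compl]
      exact hN0
  · exact hac

theorem mutuallySingular_restrict_atoms [SFinite μ] {ν : Measure ℝ} (hν : ∀ x, ν {x} = 0) :
    μ.restrict (atoms μ) ⟂ₘ ν := by
  have hat := (countable_atoms μ).measurableSet
  refine ⟨(atoms μ)ᶜ, hat.compl, by simp [Measure.restrict_apply hat.compl], ?_⟩
  rw [compl_compl]
  refine measure_eq_zero_of_countable_of_disjoint_atoms (countable_atoms μ) ?_
  rw [atoms_eq_empty_iff.2 hν]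
  exact Set.disjoint_empty _

theorem restrict_compl_carrier_sc_le :
    μ.restrict (carrier μ N .sc)ᶜ ≤ μ.restrict Nᶜ + μ.restrict (atoms μ) := by
  rw [carrier, Set.sdiff_eq_compl_inter, Set.compl_inter, compl_compl, Set.union_comm]
  exact Measure.restrict_union_le _ _

theorem mutuallySingular_restrict_compl_carrier [SFinite μ] (hN : MeasurableSet N)
    (hN0 : volume N = 0) (hac : μ.restrict Nᶜ ≪ volume) {κ : SpectralType} {ν : Measure ℝ}
    (hν : κ.Holds ν) : μ.restrict (carrier μ N κ)ᶜ ⟂ₘ ν := by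
  cases κ
  · obtain ⟨S, hS, h0⟩ := hν
    refine ⟨S, hS.measurableSet, ?_, h0⟩
    rw [Measure.restrict_apply hS.measurableSet]
    exact measure_eq_zero_of_countable_of_disjoint_atoms (hS.mono Set.inter_subset_left)
      (Set.disjoint_left.2 fun x hx => hx.2)
  · exact ((hν.2.symm.mono_ac hac .rfl).add_left (mutuallySingular_restrict_atoms hν.1)).mono_ac
      (Measure.absolutelyContinuous_of_le restrict_compl_carrier_sc_le) .rfl
  · refine ⟨Nᶜ, hN.compl, by simp [Measure.restrict_apply hN.compl, carrier], ?_⟩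
    rw [compl_compl]
    exact hν hN0

end Carrier

theorem exists_mem_spectralSubspace_iff (hA : IsSelfAdjoint A) {ι : Type*} {e : ι → H}
    (he : ∀ ψ, (∀ i, ⟪e i, ψ⟫_ℂ = 0) → ψ = 0) {N : ι → Set ℝ} (hN : ∀ i, MeasurableSet (N i))
    (hN0 : ∀ i, volume (N i) = 0)
    (hac : ∀ i, (spectralMeasure A (e i)).restrict (N i)ᶜ ≪ volume) (κ : SpectralType)
    {J : Set ℝ} (hJ : MeasurableSet J) :
    (∃ φ ∈ spectralSubspace A κ, spectralMeasure A φ J ≠ 0) ↔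
      ∃ i, spectralMeasure A (e i) (J ∩ carrier (spectralMeasure A (e i)) (N i) κ) ≠ 0 := by
  have hC (i : ι) := measurableSet_carrier (μ := spectralMeasure A (e i)) (hN i) κ
  constructor
  · rintro ⟨φ, hφ, hφJ⟩
    obtain ⟨ψ, hψ⟩ := exists_spectralMeasure_eq_restrict A φ hJ
    have hψκ : κ.Holds (spectralMeasure A ψ) :=
      SpectralType.Holds.mono hφ (absolutelyContinuous_of_eq_restrict hψ)
    by_contra! hcon
    refine ne_zero_of_spectralMeasure_eq_restrict hψ hφJ (he ψ fun i => ?_)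
    refine inner_eq_zero_of_mutuallySingular hA ?_
    rw [← Measure.restrict_add_restrict_compl (μ := spectralMeasure A (e i)) (hC i)]
    refine .add_left ⟨J, hJ, ?_, ?_⟩
      (mutuallySingular_restrict_compl_carrier (hN i) (hN0 i) (hac i) hψκ)
    · rw [Measure.restrict_apply hJ, hcon i]
    · rw [hψ, Measure.restrict_apply hJ.compl, Set.compl_inter_self, measure_empty]
  · rintro ⟨i, hi⟩
    obtain ⟨ψ, hψ⟩ := exists_spectralMeasure_eq_restrict A (e i) (hC i)
    have hψκ : κ.Holds (spectralMeasure A ψ) :=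
      hψ ▸ holds_restrict_carrier (hN i) (hN0 i) (hac i) κ
    exact ⟨ψ, hψκ, by rwa [hψ, Measure.restrict_apply hJ]⟩

theorem spectralSubspace_pp_eq_top (hA : IsSelfAdjoint A) {ι : Type*} [Countable ι] {e : ι → H}
    (he : ∀ ψ, (∀ i, ⟪e i, ψ⟫_ℂ = 0) → ψ = 0) (h : ∀ i, e i ∈ spectralSubspace A .pp) :
    spectralSubspace A .pp = ⊤ := by
  choose S hS h0 using h
  have hT : (⋃ i, S i).Countable := Set.countable_iUnion hS
  refine eq_top_iff.2 fun φ _ => ⟨⋃ i, S i, hT, ?_⟩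
  obtain ⟨ψ, hψ⟩ := exists_spectralMeasure_eq_restrict A φ hT.measurableSet.compl
  have hψ0 : ψ = 0 := he ψ fun i => inner_eq_zero_of_mutuallySingular hA <| by
    refine ⟨(⋃ i, S i)ᶜ, hT.measurableSet.compl,
      measure_mono_null (Set.compl_subset_compl.2 (Set.subset_iUnion S i)) (h0 i), ?_⟩
    rw [hψ, compl_compl, Measure.restrict_apply hT.measurableSet, Set.inter_compl_self,
      measure_empty]
  rw [hψ0, spectralMeasure_zero] at hψ
  exact Measure.restrict_eq_zero.1 hψ.symm

theorem eq_zero_of_mem_pp_of_forall_singleton (hA : IsSelfAdjoint A) {φ : H}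
    (hpp : φ ∈ spectralSubspace A .pp) (h : ∀ x, spectralMeasure A φ {x} = 0) : φ = 0 := by
  obtain ⟨S, hS, h0⟩ := hpp
  have hS0 : spectralMeasure A φ S = 0 := by
    refine measure_eq_zero_of_countable_of_disjoint_atoms hS ?_
    rw [atoms_eq_empty_iff.2 h]
    exact Set.disjoint_empty S
  rw [← spectralMeasure_eq_zero_iff hA, ← Measure.measure_univ_eq_zero, ← Set.union_compl_self S]
  exact measure_union_null hS0 h0

theorem spectralComponent_eq_empty (hA : IsSelfAdjoint A) (hpp : spectralSubspace A .pp = ⊤)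
    {κ : SpectralType} (hκ : κ ≠ .pp) : spectralComponent A κ = ∅ := by
  refine Set.eq_empty_of_forall_notMem fun E hE => ?_
  obtain ⟨φ, hφ, hne⟩ := (mem_spectralComponent_iff hA κ E).1 hE 1 one_pos
  refine hne ?_
  have hx (x : ℝ) : spectralMeasure A φ {x} = 0 := by
    cases κ
    · exact absurd rfl hκ
    · exact hφ.1 x
    · exact hφ (measure_singleton x)
  rw [eq_zero_of_mem_pp_of_forall_singleton hA (hpp ▸ Submodule.mem_top) hx, spectralMeasure_zero,
    Measure.coe_zero, Pi.zero_apply]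

theorem mem_pp_of_aeval_eq_zero (hA : IsSelfAdjoint A) {φ : H} {q : Polynomial ℝ} (hq : q ≠ 0)
    (h : Polynomial.aeval A q φ = 0) : φ ∈ spectralSubspace A .pp := by
  refine ⟨q.rootSet ℝ, (q.rootSet_finite ℝ).countable, ?_⟩
  have hae := norm_sq_cfc_apply A φ q.continuous
  rw [cfc_polynomial q A, h, norm_zero, zero_pow two_ne_zero, eq_comm,
    integral_eq_zero_iff_of_nonneg (fun x => sq_nonneg _)
      (integrable_spectralMeasure A φ (q.continuous.pow 2))] at hae
  refine measure_mono_null (fun x hx => ?_) hae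
  have hroot : q.eval x ≠ 0 := fun h =>
    hx ((Polynomial.mem_rootSet_of_ne hq).2 (by simpa using h))
  simpa using hroot

theorem spectralMeasure_conj (hA : IsSelfAdjoint A) (U : H ≃ₗᵢ[ℂ] H) {B : H →L[ℂ] H}
    (hB : IsSelfAdjoint B) (hAB : ∀ φ, B φ = U.symm (A (U φ))) (φ : H) :
    spectralMeasure B φ = spectralMeasure A (U φ) := by
  refine Measure.ext_of_integral_eq_on_compactlySupported fun f => ?_
  have hconj : U.symm.conjStarAlgEquiv A = B := by
    ext ψ
    simp [hAB]
  have hcont : Continuous U.symm.conjStarAlgEquiv :=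
    continuous_const.clm_comp (continuous_id.clm_comp continuous_const)
  have hcfc := StarAlgHomClass.map_cfc (S := ℂ) U.symm.conjStarAlgEquiv (f : ℝ → ℝ) A
    f.continuous.continuousOn hcont hA (hconj ▸ hB)
  rw [integral_spectralMeasure, integral_spectralMeasure, ← hconj, ← hcfc,
    LinearIsometryEquiv.conjStarAlgEquiv_apply_apply, ← U.inner_map_map]
  simp

end SpectralComponents

section RandomOperators

variable {H : Type*} [NormedAddCommGroup H] [InnerProductSpace ℂ H] [CompleteSpace H]
  {Ω : Type*} [MeasurableSpace Ω]

section Measurability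

variable {A : Ω → H →L[ℂ] H} {φ : H}

theorem integral_eval_spectralMeasure {T : H →L[ℂ] H} (hT : IsSelfAdjoint T) (φ : H)
    (q : Polynomial ℝ) :
    ∫ x, q.eval x ∂(spectralMeasure T φ) = q.sum fun n a => a * (⟪φ, (T ^ n) φ⟫_ℂ).re := by
  have hq : Polynomial.aeval T q φ = ∑ n ∈ q.support, (q.coeff n : ℂ) • (T ^ n) φ := by
    rw [Polynomial.aeval_eq_sum_range, ← Finset.sum_subset q.supp_subset_range_natDegree_succ,
      sum_apply]
    · rfl
    · intro n _ hn
      rw [Polynomial.notMem_support_iff.1 hn, zero_smul]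
  rw [integral_spectralMeasure_of_continuous _ _ q.continuous, cfc_polynomial q T hT, hq,
    inner_sum, Complex.re_sum]
  exact Finset.sum_congr rfl fun n _ => by rw [inner_smul_right, Complex.re_ofReal_mul]

theorem tendsto_integral_eval_spectralMeasure (T : H →L[ℂ] H) (φ : H) {f : ℝ → ℝ}
    (hf : Continuous f) {q : ℕ → Polynomial ℝ}
    (hq : ∀ k : ℕ, ∀ x ∈ Set.Icc (-(k : ℝ)) k, |(q k).eval x - f x| < 1 / ((k : ℝ) + 1)) :
    Tendsto (fun k => ∫ x, (q k).eval x ∂(spectralMeasure T φ)) atTop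
      (𝓝 (∫ x, f x ∂(spectralMeasure T φ))) := by
  obtain ⟨R, hR⟩ := (ContinuousFunctionalCalculus.isCompact_spectrum (R := ℝ)
    T).isBounded.subset_closedBall 0
  rw [tendsto_iff_norm_sub_tendsto_zero]
  have hlim := tendsto_one_div_add_atTop_nhds_zero_nat.mul_const
    ((spectralMeasure T φ).real Set.univ)
  rw [zero_mul] at hlim
  refine squeeze_zero' (.of_forall fun k => norm_nonneg _) ?_ hlim
  filter_upwards [eventually_ge_atTop ⌈R⌉₊] with k hk
  rw [← integral_sub (integrable_spectralMeasure _ _ (q k).continuous)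
    (integrable_spectralMeasure _ _ hf)]
  refine norm_integral_le_of_norm_le_const ?_
  filter_upwards [ae_mem_spectrum T φ] with x hx
  have hxR : |x| ≤ R := by simpa using hR hx
  exact (hq k x (abs_le.1 (hxR.trans (Nat.ceil_le.1 hk)))).le

theorem measurable_integral_spectralMeasure (hA : ∀ ω, IsSelfAdjoint (A ω))
    (hm : ∀ n : ℕ, Measurable fun ω => ⟪φ, (A ω ^ n) φ⟫_ℂ) {f : ℝ → ℝ} (hf : Continuous f) :
    Measurable fun ω => ∫ x, f x ∂(spectralMeasure (A ω) φ) := by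
  choose q hq using fun k : ℕ => exists_polynomial_near_of_continuousOn (-(k : ℝ)) k f
    hf.continuousOn (1 / ((k : ℝ) + 1)) (by positivity)
  refine measurable_of_tendsto_metrizable
    (f := fun k ω => ∫ x, (q k).eval x ∂(spectralMeasure (A ω) φ)) (fun k => ?_)
    (tendsto_pi_nhds.2 fun ω => tendsto_integral_eval_spectralMeasure (A ω) φ hf hq)
  simp only [integral_eval_spectralMeasure (hA _), Polynomial.sum_def]
  exact Finset.measurable_sum _ fun n _ => (Complex.measurable_re.comp (hm n)).const_mul _

theorem measurable_spectralMeasure (hA : ∀ ω, IsSelfAdjoint (A ω))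
    (hm : ∀ n : ℕ, Measurable fun ω => ⟪φ, (A ω ^ n) φ⟫_ℂ) :
    Measurable fun ω => spectralMeasure (A ω) φ := by
  have hclosed (F : Set ℝ) (hF : IsClosed F) : Measurable fun ω => spectralMeasure (A ω) φ F := by
    refine measurable_of_tendsto_metrizable (f := fun n ω =>
      ∫⁻ x, hF.apprSeq n x ∂(spectralMeasure (A ω) φ)) (fun n => ?_) (tendsto_pi_nhds.2 fun ω =>
        HasOuterApproxClosed.tendsto_lintegral_apprSeq hF _)
    have hc : Continuous fun x => (hF.apprSeq n x : ℝ) :=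
      NNReal.continuous_coe.comp (hF.apprSeq n).continuous
    have hint (ω : Ω) : ∫⁻ x, hF.apprSeq n x ∂(spectralMeasure (A ω) φ) =
        ENNReal.ofReal (∫ x, (hF.apprSeq n x : ℝ) ∂(spectralMeasure (A ω) φ)) := by
      rw [ofReal_integral_eq_lintegral_ofReal (integrable_spectralMeasure _ _ hc)
        (.of_forall fun x => NNReal.coe_nonneg _)]
      simp only [ENNReal.ofReal_coe_nnreal]
    simp only [hint]
    exact (measurable_integral_spectralMeasure hA hm hc).ennreal_ofReal
  refine Measurable.measure_of_isPiSystem (S := {s | IsClosed s}) ?_ isPiSystem_isClosed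
    hclosed (hclosed _ isClosed_univ)
  rw [BorelSpace.measurable_eq (α := ℝ), borel_eq_generateFrom_isClosed]

end Measurability

/-- A jointly measurable choice of Lebesgue-null sets off which the measures of a kernel are
absolutely continuous. The standard Gaussian stands in for Lebesgue measure, which it is equivalent
to, because the Lebesgue decomposition of kernels is available for finite kernels only. -/
noncomputable def singularSet (μ : Kernel Ω ℝ) (ω : Ω) : Set ℝ :=
  μ.mutuallySingularSetSlice (Kernel.const Ω (gaussianReal 0 1)) ω

theorem measurableSet_singularSet (μ : Kernel Ω ℝ) (ω : Ω) : MeasurableSet (singularSet μ ω) :=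
  Kernel.measurableSet_mutuallySingularSetSlice _ _ _

theorem volume_singularSet (μ : Kernel Ω ℝ) [IsFiniteKernel μ] (ω : Ω) :
    volume (singularSet μ ω) = 0 :=
  gaussianReal_absolutelyContinuous' 0 one_ne_zero
    (Kernel.measure_mutuallySingularSetSlice μ (Kernel.const Ω (gaussianReal 0 1)) ω)

theorem restrict_compl_singularSet (μ : Kernel Ω ℝ) [IsFiniteKernel μ] (ω : Ω) :
    (μ ω).restrict (singularSet μ ω)ᶜ ≪ volume := by
  set η := Kernel.const Ω (gaussianReal 0 1)
  intro s hs
  have hηs : η ω s = 0 := gaussianReal_absolutelyContinuous 0 one_ne_zero hs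
  have hm := (measurableSet_singularSet μ ω).compl
  rw [Measure.restrict_apply₀' hm.nullMeasurableSet]
  nth_rewrite 1 [← Kernel.rnDeriv_add_singularPart μ η]
  rw [add_apply, Measure.add_apply, add_eq_zero]
  constructor
  · rw [Kernel.withDensity_apply _ (Kernel.measurable_rnDeriv μ η)]
    exact withDensity_absolutelyContinuous _ _ (measure_mono_null Set.inter_subset_left hηs)
  · exact measure_mono_null Set.inter_subset_right
      (Kernel.singularPart_compl_mutuallySingularSetSlice μ η ω)

theorem measurableSet_carrier_prod (μ : Kernel Ω ℝ) [IsFiniteKernel μ] (κ : SpectralType) :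
    MeasurableSet {p : Ω × ℝ | p.2 ∈ carrier (μ p.1) (singularSet μ p.1) κ} := by
  have hsingular : MeasurableSet {p : Ω × ℝ | p.2 ∈ singularSet μ p.1} :=
    Kernel.measurableSet_mutuallySingularSet μ (Kernel.const Ω (gaussianReal 0 1))
  have hatoms : MeasurableSet {p : Ω × ℝ | p.2 ∈ atoms (μ p.1)} := by
    have hd : MeasurableSet {q : (Ω × ℝ) × ℝ | q.2 = q.1.2} :=
      measurableSet_eq_fun measurable_snd (measurable_snd.comp measurable_fst)
    have h := Kernel.measurable_kernel_prodMk_left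
      (κ := μ.comap (Prod.fst : Ω × ℝ → Ω) measurable_fst) hd
    exact h (measurableSet_singleton 0).compl
  cases κ
  · exact hatoms
  · exact hsingular.diff hatoms
  · exact hsingular.compl

theorem measurableSet_measure_inter_carrier_ne_zero (μ : Kernel Ω ℝ) [IsFiniteKernel μ]
    (κ : SpectralType) {J : Set ℝ} (hJ : MeasurableSet J) :
    MeasurableSet {ω | μ ω (J ∩ carrier (μ ω) (singularSet μ ω) κ) ≠ 0} := by
  have h := Kernel.measurable_kernel_prodMk_left (κ := μ)
    ((measurable_snd hJ).inter (measurableSet_carrier_prod μ κ))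
  exact h (measurableSet_singleton 0).compl

theorem measurable_of_hasSum {ι : Type*} [Countable ι] {f : ι → Ω → ℂ} {g : Ω → ℂ}
    (hf : ∀ i, Measurable (f i)) (h : ∀ ω, HasSum (fun i => f i ω) (g ω)) : Measurable g := by
  classical
  refine measurable_of_tendsto_metrizable' (atTop : Filter (Finset ι))
    (f := fun s ω => ∑ i ∈ s, f i ω) (fun s => Finset.measurable_sum _ fun i _ => hf i)
    (tendsto_pi_nhds.2 fun ω => h ω)

theorem measurable_inner_pow {ι : Type*} [Countable ι] (b : HilbertBasis ι ℂ H)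
    {A : Ω → H →L[ℂ] H} (hm : ∀ φ ψ : H, Measurable fun ω => ⟪φ, A ω ψ⟫_ℂ) (n : ℕ) (φ ψ : H) :
    Measurable fun ω => ⟪φ, (A ω ^ n) ψ⟫_ℂ := by
  induction n generalizing ψ with
  | zero => simp
  | succ n ih =>
    refine measurable_of_hasSum (f := fun i ω => ⟪φ, (A ω ^ n) (b i)⟫_ℂ * ⟪b i, A ω ψ⟫_ℂ)
      (fun i => (ih (b i)).mul (hm (b i) ψ)) fun ω => ?_
    have hadj : ∀ v, ⟪φ, (A ω ^ n) v⟫_ℂ = ⟪(A ω ^ n).adjoint φ, v⟫_ℂ := fun v =>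
      (ContinuousLinearMap.adjoint_inner_left _ _ _).symm
    simp only [pow_succ, mul_apply_eq_comp, hadj]
    exact b.hasSum_inner_mul_inner _ _

theorem eq_zero_of_forall_hilbertBasis_inner_eq_zero {ι E : Type*} [NormedAddCommGroup E]
    [InnerProductSpace ℂ E] (b : HilbertBasis ι ℂ E) {ψ : E} (h : ∀ i, ⟪b i, ψ⟫_ℂ = 0) :
    ψ = 0 := by
  have hsum := b.hasSum_inner_mul_inner ψ ψ
  simp only [h, mul_zero] at hsum
  exact inner_self_eq_zero.1 (hsum.unique hasSum_zero)

variable {P : Measure Ω} {Γ : Type*} [AddGroup Γ] {τ : Γ → Ω → Ω} {U : Γ → H ≃ₗᵢ[ℂ] H}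
  {A : Ω → H →L[ℂ] H}

/-- The event that some vector of the spectral subspace of type `κ` has a spectral measure that
charges `J`. The spectral component of `A ω` is determined by the countably many of these events in
which `J` is an open interval with rational end points. -/
def chargeEvent {Ω : Type*} (A : Ω → H →L[ℂ] H) (κ : SpectralType) (J : Set ℝ) : Set Ω :=
  {ω | ∃ φ ∈ spectralSubspace (A ω) κ, spectralMeasure (A ω) φ J ≠ 0}

theorem measurableSet_chargeEvent {ι : Type*} [Countable ι] (b : HilbertBasis ι ℂ H)
    (hA : ∀ ω, IsSelfAdjoint (A ω)) (hm : ∀ φ ψ : H, Measurable fun ω => ⟪φ, A ω ψ⟫_ℂ)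
    (κ : SpectralType) {J : Set ℝ} (hJ : MeasurableSet J) :
    MeasurableSet (chargeEvent A κ J) := by
  let μ (i : ι) : Kernel Ω ℝ := ⟨fun ω => spectralMeasure (A ω) (b i),
    measurable_spectralMeasure hA fun n => measurable_inner_pow b hm n _ _⟩
  have hfin (i : ι) : IsFiniteKernel (μ i) := ⟨1, ENNReal.one_lt_top, fun ω => by
    have hnorm := norm_sq_eq_spectralMeasure (hA ω) (b i)
    rw [b.orthonormal.1 i, one_pow, measureReal_def, eq_comm, ENNReal.toReal_eq_one_iff] at hnorm
    exact hnorm.le⟩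
  have hunion : chargeEvent A κ J =
      ⋃ i, {ω | μ i ω (J ∩ carrier (μ i ω) (singularSet (μ i) ω) κ) ≠ 0} := by
    ext ω
    rw [Set.mem_iUnion]
    exact exists_mem_spectralSubspace_iff (hA ω)
      (fun ψ => eq_zero_of_forall_hilbertBasis_inner_eq_zero b)
      (fun i => measurableSet_singularSet (μ i) ω) (fun i => volume_singularSet (μ i) ω)
      (fun i => restrict_compl_singularSet (μ i) ω) κ hJ
  rw [hunion]
  exact MeasurableSet.iUnion fun i => measurableSet_measure_inter_carrier_ne_zero (μ i) κ hJ

theorem exists_mem_spectralSubspace_iff_of_conj {T B : H →L[ℂ] H} (hT : IsSelfAdjoint T)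
    (hB : IsSelfAdjoint B) (V : H ≃ₗᵢ[ℂ] H) (h : ∀ φ, B φ = V.symm (T (V φ)))
    (κ : SpectralType) (J : Set ℝ) :
    (∃ φ ∈ spectralSubspace B κ, spectralMeasure B φ J ≠ 0) ↔
      ∃ φ ∈ spectralSubspace T κ, spectralMeasure T φ J ≠ 0 := by
  change (∃ φ, κ.Holds (spectralMeasure B φ) ∧ spectralMeasure B φ J ≠ 0) ↔
    ∃ φ, κ.Holds (spectralMeasure T φ) ∧ spectralMeasure T φ J ≠ 0
  simp only [spectralMeasure_conj hT V hB h]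
  exact (V.surjective.exists
    (p := fun ψ => κ.Holds (spectralMeasure T ψ) ∧ spectralMeasure T ψ J ≠ 0)).symm

theorem IsErgodicRandomOperator.prob_chargeEvent (h : IsErgodicRandomOperator P τ U A)
    {ι : Type*} [Countable ι] (b : HilbertBasis ι ℂ H) (κ : SpectralType) {J : Set ℝ}
    (hJ : MeasurableSet J) : P (chargeEvent A κ J) = 0 ∨ P (chargeEvent A κ J) = 1 := by
  refine h.ergodic _ (measurableSet_chargeEvent b h.isSelfAdjoint h.measurable_inner κ hJ)
    fun z => ?_
  ext ω
  exact exists_mem_spectralSubspace_iff_of_conj (h.isSelfAdjoint ω) (h.isSelfAdjoint (τ z ω))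
    (U z) (h.covariant z ω) κ J

theorem ofReal_mem_spectralComponent_iff {T : H →L[ℂ] H} (hT : IsSelfAdjoint T)
    (κ : SpectralType) (E : ℝ) :
    (E : ℂ) ∈ spectralComponent T κ ↔ ∀ a b : ℚ, (a : ℝ) < E → E < b →
      ∃ φ ∈ spectralSubspace T κ, spectralMeasure T φ (Set.Ioo a b) ≠ 0 := by
  have hball (ε : ℝ) : {x : ℝ | ‖(x : ℂ) - E‖ < ε} = Metric.ball E ε := by
    ext x
    rw [Set.mem_ofPred_eq, ← Complex.ofReal_sub, Complex.norm_real, mem_ball_iff_norm]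
  simp only [mem_spectralComponent_iff hT, hball]
  constructor
  · intro h a b ha hb
    obtain ⟨ε, hε, hsub⟩ := Metric.mem_nhds_iff.1 (Ioo_mem_nhds ha hb)
    obtain ⟨φ, hφ, hne⟩ := h ε hε
    exact ⟨φ, hφ, fun h0 => hne (measure_mono_null hsub h0)⟩
  · intro h ε hε
    obtain ⟨a, ha, haE⟩ := exists_rat_btwn (sub_lt_self E hε)
    obtain ⟨b, hEb, hb⟩ := exists_rat_btwn (lt_add_of_pos_right E hε)
    obtain ⟨φ, hφ, hne⟩ := h a b haE hEb
    refine ⟨φ, hφ, fun h0 => hne (measure_mono_null ?_ h0)⟩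
    rw [Real.ball_eq_Ioo]
    exact Set.Ioo_subset_Ioo ha.le hb.le

theorem spectralComponent_eq_image {Ω : Type*} {A : Ω → H →L[ℂ] H}
    (hA : ∀ ω, IsSelfAdjoint (A ω)) (κ : SpectralType) (ω : Ω) :
    spectralComponent (A ω) κ = Complex.ofReal ''
      {E : ℝ | ∀ a b : ℚ, (a : ℝ) < E → E < b → ω ∈ chargeEvent A κ (Set.Ioo a b)} := by
  ext E
  constructor
  · intro hE
    have hre := (hA ω).mem_spectrum_eq_re (spectralComponent_subset_spectrum (hA ω) κ hE)
    exact ⟨E.re, (ofReal_mem_spectralComponent_iff (hA ω) κ E.re).1 (hre ▸ hE), hre.symm⟩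
  · rintro ⟨E, hE, rfl⟩
    exact (ofReal_mem_spectralComponent_iff (hA ω) κ E).2 hE

theorem IsErgodicRandomOperator.exists_spectralComponent_eq [IsProbabilityMeasure P]
    (h : IsErgodicRandomOperator P τ U A) {ι : Type*} [Countable ι] (b : HilbertBasis ι ℂ H)
    (κ : SpectralType) :
    ∃ T : Set ℝ, IsClosed T ∧ ∀ᵐ ω ∂P, spectralComponent (A ω) κ = Complex.ofReal '' T := by
  refine ⟨{E : ℝ | ∀ a b : ℚ, (a : ℝ) < E → E < b → P (chargeEvent A κ (Set.Ioo a b)) = 1},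
    ?_, ?_⟩
  · rw [← isOpen_compl_iff, isOpen_iff_mem_nhds]
    intro E hE
    obtain ⟨a, c, ha, hc, hne⟩ : ∃ a c : ℚ, (a : ℝ) < E ∧ E < c ∧
        P (chargeEvent A κ (Set.Ioo (a : ℝ) c)) ≠ 1 := by
      by_contra! hcon
      exact hE hcon
    filter_upwards [Ioo_mem_nhds ha hc] with x hx hx'
    exact hne (hx' a c hx.1 hx.2)
  · have hae : ∀ᵐ ω ∂P, ∀ a b : ℚ, ω ∈ chargeEvent A κ (Set.Ioo (a : ℝ) b) ↔
        P (chargeEvent A κ (Set.Ioo (a : ℝ) b)) = 1 := by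
      refine ae_all_iff.2 fun a => ae_all_iff.2 fun c => ?_
      have hms := measurableSet_chargeEvent b h.isSelfAdjoint h.measurable_inner κ
        (measurableSet_Ioo (a := (a : ℝ)) (b := c))
      rcases h.prob_chargeEvent b κ (measurableSet_Ioo (a := (a : ℝ)) (b := c)) with h0 | h1
      · filter_upwards [measure_eq_zero_iff_ae_notMem.1 h0] with ω hω
        simp [hω, h0]
      · filter_upwards [(mem_ae_iff_prob_eq_one hms).2 h1] with ω hω
        simp [hω, h1]
    filter_upwards [hae] with ω hω
    simp only [spectralComponent_eq_image h.isSelfAdjoint, hω]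

end RandomOperators

section LatticeLaplacian

theorem inner_single_one {ι : Type*} [DecidableEq ι] (x : ι) (φ : lp (fun _ : ι => ℂ) 2) :
    ⟪(lp.single 2 x (1 : ℂ) : lp (fun _ : ι => ℂ) 2), φ⟫_ℂ = φ x := by
  rw [lp.inner_single_left]
  simp

theorem isSelfAdjoint_of_apply_single {ι : Type*} [DecidableEq ι]
    {T : lp (fun _ : ι => ℂ) 2 →L[ℂ] lp (fun _ : ι => ℂ) 2}
    (hT : ∀ x y, T (lp.single 2 y 1) x = starRingEnd ℂ (T (lp.single 2 x 1) y)) :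
    IsSelfAdjoint T := by
  rw [ContinuousLinearMap.isSelfAdjoint_iff']
  refine lp.ext_continuousLinearMap (by simp) fun y => ContinuousLinearMap.ext_ring ?_
  ext x
  change ContinuousLinearMap.adjoint T (lp.single 2 y 1) x = T (lp.single 2 y 1) x
  rw [← inner_single_one, ContinuousLinearMap.adjoint_inner_right, ← inner_conj_symm,
    inner_single_one, hT y x, Complex.conj_conj]

variable {d : ℕ}

/-- The unit vectors of `ℤ^d` as a finite set; `x + u`, `u ∈ units d`, are the lattice neighbours
of `x`. -/
noncomputable def units (d : ℕ) : Finset (Vertex d) := (finite_unitVectors d).toFinset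

theorem mem_units {u : Vertex d} : u ∈ units d ↔ ∑ i, u i ^ 2 = 1 := by
  rw [units, Set.Finite.mem_toFinset]
  rfl

theorem lattice_adj_add_iff {x u : Vertex d} : (lattice d).Adj x (x + u) ↔ u ∈ units d := by
  rw [lattice_adj_iff, add_sub_cancel_left, units, Set.Finite.mem_toFinset]

theorem neg_mem_units {u : Vertex d} : -u ∈ units d ↔ u ∈ units d := by
  simp [mem_units]

theorem sum_units_neg {M : Type*} [AddCommMonoid M] (f : Vertex d → M) :
    ∑ u ∈ units d, f (-u) = ∑ u ∈ units d, f u :=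
  Finset.sum_nbij' (fun u => -u) (fun u => -u) (fun _ hu => neg_mem_units.2 hu)
    (fun _ hu => neg_mem_units.2 hu) (fun _ _ => neg_neg _) (fun _ _ => neg_neg _) fun _ _ => rfl

theorem exists_eq_single_of_mem_units {u : Vertex d} (hu : u ∈ units d) :
    ∃ i, ∃ s : ℤ, (s = 1 ∨ s = -1) ∧ u = Pi.single i s := by
  have hsum := mem_units.1 hu
  obtain ⟨i, hi⟩ : ∃ i, u i ≠ 0 := by
    by_contra! h0
    simp [h0] at hsum
  have hpos : 0 < u i ^ 2 := by positivity
  have hrest : ∑ j ∈ Finset.univ.erase i, u j ^ 2 = 1 - u i ^ 2 := by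
    rw [← hsum, ← Finset.add_sum_erase _ _ (Finset.mem_univ i), add_sub_cancel_left]
  have hnonneg : 0 ≤ ∑ j ∈ Finset.univ.erase i, u j ^ 2 :=
    Finset.sum_nonneg fun j _ => sq_nonneg (u j)
  have hsq : u i ^ 2 = 1 := by lia
  refine ⟨i, u i, sq_eq_one_iff.1 hsq, funext fun j => ?_⟩
  rcases eq_or_ne j i with rfl | hj
  · rw [Pi.single_eq_same]
  · rw [hsq, sub_self, Finset.sum_eq_zero_iff_of_nonneg fun j _ => sq_nonneg (u j)] at hrest
    rw [Pi.single_eq_of_ne hj]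
    exact pow_eq_zero_iff two_ne_zero |>.1 (hrest j (Finset.mem_erase.2 ⟨hj, Finset.mem_univ j⟩))

theorem single_mem_units (i : Fin d) {s : ℤ} (hs : s = 1 ∨ s = -1) :
    (Pi.single i s : Vertex d) ∈ units d := by
  rw [mem_units, Finset.sum_eq_single i (fun j _ hj => by simp [hj]) (by simp)]
  rcases hs with rfl | rfl <;> simp

theorem card_units (d : ℕ) : (units d).card = 2 * d := by
  have himage : units d = (Finset.univ ×ˢ ({1, -1} : Finset ℤ)).image
      fun q : Fin d × ℤ => (Pi.single q.1 q.2 : Vertex d) := by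
    ext u
    simp only [Finset.mem_image, Finset.mem_product, Finset.mem_univ, true_and, Finset.mem_insert,
      Finset.mem_singleton, Prod.exists]
    constructor
    · intro hu
      obtain ⟨i, s, hs, rfl⟩ := exists_eq_single_of_mem_units hu
      exact ⟨i, s, hs, rfl⟩
    · rintro ⟨i, s, hs, rfl⟩
      exact single_mem_units i hs
  have hinj : Set.InjOn (fun q : Fin d × ℤ => (Pi.single q.1 q.2 : Vertex d))
      (Finset.univ ×ˢ ({1, -1} : Finset ℤ) : Finset (Fin d × ℤ)) := by
    rintro ⟨i, s⟩ hs ⟨j, t⟩ _ hst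
    have hs0 : s ≠ 0 := by
      rintro rfl
      simp at hs
    have hval : s = (Pi.single j t : Vertex d) i := by
      simpa only [Pi.single_eq_same] using congrFun hst i
    obtain rfl : i = j := by
      by_contra hij
      exact hs0 (hval.trans (Pi.single_eq_of_ne hij _))
    rw [hval, Pi.single_eq_same]
  rw [himage, Finset.card_image_of_injOn hinj, Finset.card_product]
  simp [mul_comm]

open Classical in
theorem neighbors_eq_image {G : SimpleGraph (Vertex d)} (hG : G ≤ lattice d) (x : Vertex d) :
    neighbors hG x = ((units d).filter fun u => G.Adj x (x + u)).image (x + ·) := by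
  ext y
  simp only [mem_neighbors, Finset.mem_image, Finset.mem_filter]
  constructor
  · intro h
    obtain ⟨u, rfl⟩ : ∃ u, y = x + u := ⟨y - x, by simp⟩
    exact ⟨u, ⟨lattice_adj_add_iff.1 (hG h), h⟩, rfl⟩
  · rintro ⟨u, ⟨-, h⟩, rfl⟩
    exact h

open Classical in
theorem sum_neighbors {M : Type*} [AddCommMonoid M] {G : SimpleGraph (Vertex d)}
    (hG : G ≤ lattice d) (x : Vertex d) (f : Vertex d → M) :
    ∑ y ∈ neighbors hG x, f y = ∑ u ∈ units d, if G.Adj x (x + u) then f (x + u) else 0 := by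
  rw [neighbors_eq_image, Finset.sum_image (fun u _ v _ h => add_left_cancel h),
    Finset.sum_filter]

/-- The weight with which an absent lattice edge `[x, y]` contributes a multiple of `φ x` to
`Δ_X φ - 2d φ`, where a present edge contributes `-φ y`. -/
noncomputable def absentEdgeWeight : BoundaryCondition → ℂ
  | .neumann => -1
  | .pseudoDirichlet => 0
  | .dirichlet => 1

theorem norm_absentEdgeWeight_le (X : BoundaryCondition) : ‖absentEdgeWeight X‖ ≤ 1 := by
  cases X <;> simp [absentEdgeWeight]

theorem laplacian_apply (X : BoundaryCondition) {G : SimpleGraph (Vertex d)} (hG : G ≤ lattice d)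
    (φ : L2 d) (x : Vertex d) :
    laplacian X hG φ x = 2 * d * φ x + absentEdgeWeight X * (2 * d - vertexDegree hG x) * φ x -
      ∑ y ∈ neighbors hG x, φ y := by
  cases X
  · change (vertexDegree hG x : ℂ) * φ x - ∑ y ∈ neighbors hG x, φ y = _
    simp only [absentEdgeWeight]
    ring
  · change ((2 * d : ℂ) * φ x - (vertexDegree hG x : ℂ) * φ x) +
      ((vertexDegree hG x : ℂ) * φ x - ∑ y ∈ neighbors hG x, φ y) = _
    simp only [absentEdgeWeight]
    ring
  · change (2 : ℂ) * ((2 * d : ℂ) * φ x - (vertexDegree hG x : ℂ) * φ x) +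
      ((vertexDegree hG x : ℂ) * φ x - ∑ y ∈ neighbors hG x, φ y) = _
    simp only [absentEdgeWeight]
    ring

open Classical in
theorem laplacian_apply_eq_sum_units (X : BoundaryCondition) {G : SimpleGraph (Vertex d)}
    (hG : G ≤ lattice d) (φ : L2 d) (x : Vertex d) :
    laplacian X hG φ x = 2 * d * φ x +
      ∑ u ∈ units d, if G.Adj x (x + u) then -φ (x + u) else absentEdgeWeight X * φ x := by
  have hdeg : (2 * d - vertexDegree hG x : ℂ) =
      ∑ u ∈ units d, if G.Adj x (x + u) then (0 : ℂ) else 1 := by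
    have hcard : (2 * d : ℂ) = ∑ _u ∈ units d, (1 : ℂ) := by simp [card_units]
    rw [hcard, vertexDegree, Finset.card_eq_sum_ones, Nat.cast_sum, sum_neighbors,
      ← Finset.sum_sub_distrib]
    refine Finset.sum_congr rfl fun u _ => ?_
    split_ifs <;> simp
  rw [laplacian_apply, sum_neighbors, hdeg, add_sub_assoc, Finset.mul_sum, Finset.sum_mul,
    ← Finset.sum_sub_distrib]
  congr 1
  refine Finset.sum_congr rfl fun u _ => ?_
  split_ifs <;> simp

theorem laplacian_translation (X : BoundaryCondition) {G G' : SimpleGraph (Vertex d)}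
    (hG : G ≤ lattice d) (hG' : G' ≤ lattice d) (z : Vertex d) (φ : L2 d)
    (hadj : ∀ x, φ x ≠ 0 → ∀ y, G'.Adj (x + z) (y + z) ↔ G.Adj x y) :
    laplacian X hG' (translation z φ) = translation z (laplacian X hG φ) := by
  classical
  ext v
  obtain ⟨x, rfl⟩ : ∃ x, v = x + z := ⟨v - z, by simp⟩
  simp only [translation_apply, laplacian_apply_eq_sum_units, add_sub_cancel_right,
    add_right_comm x z]
  congr 1
  refine Finset.sum_congr rfl fun u _ => ?_
  by_cases hx : φ x = 0
  · by_cases hu : φ (x + u) = 0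
    · simp [hx, hu]
    · have := hadj (x + u) hu x
      rw [G'.adj_comm, G.adj_comm] at this
      rw [if_congr this rfl rfl]
  · rw [if_congr (hadj x hx (x + u)) rfl rfl]

theorem isSelfAdjoint_laplacian (X : BoundaryCondition) {G : SimpleGraph (Vertex d)}
    (hG : G ≤ lattice d) : IsSelfAdjoint (laplacian X hG) := by
  classical
  refine isSelfAdjoint_of_apply_single fun x y => ?_
  have hreal : starRingEnd ℂ (absentEdgeWeight X) = absentEdgeWeight X := by
    cases X <;> simp [absentEdgeWeight]
  rcases eq_or_ne x y with rfl | hxy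
  · simp only [laplacian_apply, lp.single_apply, Pi.single_apply]
    simp [hreal, apply_ite (starRingEnd ℂ), map_ofNat]
  · simp only [laplacian_apply, lp.single_apply, Pi.single_apply]
    simp [hxy, hxy.symm, mem_neighbors, G.adj_comm, apply_ite (starRingEnd ℂ)]

theorem summable_norm_sq (φ : L2 d) : Summable fun x => ‖φ x‖ ^ 2 :=
  (memLp_two_iff _).1 φ.2

open Classical in
/-- The hop from `x` in direction `u`: cross the edge `[x, x + u]` if it is present in `G`, and
stay at `x` otherwise. The direction is reversed by a crossing, so that hops can be undone. -/
noncomputable def hop (G : SimpleGraph (Vertex d)) (q : Vertex d × units d) :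
    Vertex d × units d :=
  if G.Adj q.1 (q.1 + q.2) then (q.1 + q.2, ⟨-q.2, neg_mem_units.2 q.2.2⟩) else q

theorem hop_involutive (G : SimpleGraph (Vertex d)) : Function.Involutive (hop G) := by
  rintro ⟨x, u⟩
  by_cases h : G.Adj x (x + u)
  · simp [hop, h, h.symm]
  · simp [hop, h]

theorem hasSum_norm_sq_hop (G : SimpleGraph (Vertex d)) (φ : L2 d) :
    HasSum (fun q => ‖φ (hop G q).1‖ ^ 2) (2 * d * ‖φ‖ ^ 2) := by
  have hfst : HasSum (fun q : Vertex d × units d => ‖φ q.1‖ ^ 2) (2 * d * ‖φ‖ ^ 2) := by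
    have hone := hasSum_fintype fun _ : units d => (1 : ℝ)
    have h := (summable_norm_sq φ).hasSum.mul hone <|
      (summable_norm_sq φ).mul_of_nonneg hone.summable (fun _ => sq_nonneg _) fun _ => zero_le_one
    simpa [← norm_sq_eq_tsum, card_units, mul_comm] using h
  exact (Equiv.hasSum_iff (hop_involutive G).toPerm).2 hfst

theorem norm_laplacian_sub_apply_le (X : BoundaryCondition) {G : SimpleGraph (Vertex d)}
    (hG : G ≤ lattice d) (φ : L2 d) (x : Vertex d) :
    ‖(laplacian X hG φ - (2 * d : ℂ) • φ : L2 d) x‖ ≤ ∑ u, ‖φ (hop G (x, u)).1‖ := by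
  classical
  change ‖laplacian X hG φ x - (2 * d : ℂ) * φ x‖ ≤ _
  rw [laplacian_apply_eq_sum_units, add_sub_cancel_left, ← Finset.sum_coe_sort]
  refine norm_sum_le_of_le _ fun u _ => ?_
  by_cases h : G.Adj x (x + u)
  · simp [hop, h]
  · simpa [hop, h] using
      mul_le_of_le_one_left (norm_nonneg (φ x)) (norm_absentEdgeWeight_le X)

theorem norm_laplacian_sub_le (X : BoundaryCondition) {G : SimpleGraph (Vertex d)}
    (hG : G ≤ lattice d) (φ : L2 d) :
    ‖laplacian X hG φ - (2 * d : ℂ) • φ‖ ≤ 2 * d * ‖φ‖ := by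
  have hpt : ∀ x, ‖(laplacian X hG φ - (2 * d : ℂ) • φ : L2 d) x‖ ^ 2 ≤
      2 * d * ∑ u, ‖φ (hop G (x, u)).1‖ ^ 2 := fun x =>
    calc ‖(laplacian X hG φ - (2 * d : ℂ) • φ : L2 d) x‖ ^ 2
        ≤ (∑ u, ‖φ (hop G (x, u)).1‖) ^ 2 := by
          gcongr
          exact norm_laplacian_sub_apply_le X hG φ x
      _ ≤ 2 * d * ∑ u, ‖φ (hop G (x, u)).1‖ ^ 2 := by
          simpa [card_units] using sq_sum_le_card_mul_sum_sq (s := Finset.univ)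
            (f := fun u => ‖φ (hop G (x, u)).1‖)
  have hsum : HasSum (fun x => 2 * d * ∑ u, ‖φ (hop G (x, u)).1‖ ^ 2)
      (2 * d * (2 * d * ‖φ‖ ^ 2)) :=
    ((hasSum_norm_sq_hop G φ).prod_fiberwise fun x => hasSum_fintype _).mul_left _
  refine le_of_sq_le_sq ?_ (by positivity)
  calc ‖laplacian X hG φ - (2 * d : ℂ) • φ‖ ^ 2
      ≤ 2 * d * (2 * d * ‖φ‖ ^ 2) := by
        rw [norm_sq_eq_tsum]
        exact hasSum_le hpt (summable_norm_sq _).hasSum hsum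
    _ = (2 * d * ‖φ‖) ^ 2 := by ring

theorem spectrum_laplacian_subset (X : BoundaryCondition) {G : SimpleGraph (Vertex d)}
    (hG : G ≤ lattice d) :
    spectrum ℂ (laplacian X hG) ⊆ Complex.ofReal '' Set.Icc (0 : ℝ) (4 * d) := by
  intro E hE
  refine ⟨E.re, ?_, ((isSelfAdjoint_laplacian X hG).mem_spectrum_eq_re hE).symm⟩
  have hshift : E - 2 * d ∈
      spectrum ℂ (laplacian X hG - algebraMap ℂ (L2 d →L[ℂ] L2 d) (2 * d)) := by
    rw [spectrum.mem_iff] at hE ⊢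
    rwa [map_sub, sub_sub_sub_cancel_right]
  have hnorm : ‖laplacian X hG - algebraMap ℂ (L2 d →L[ℂ] L2 d) (2 * d)‖ ≤ 2 * d :=
    ContinuousLinearMap.opNorm_le_bound _ (by positivity) fun φ => norm_laplacian_sub_le X hG φ
  have hE2 : ‖E - 2 * d‖ ≤ 2 * d := by
    refine (spectrum.norm_le_norm_mul_of_mem hshift).trans ?_
    have hone : ‖(1 : L2 d →L[ℂ] L2 d)‖ ≤ 1 := ContinuousLinearMap.norm_id_le
    exact (mul_le_of_le_one_right (norm_nonneg _) hone).trans hnorm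
  have hre : |E.re - 2 * d| ≤ 2 * d := by
    simpa using (Complex.abs_re_le_norm (E - 2 * d)).trans hE2
  rw [abs_le] at hre
  exact ⟨by linarith [hre.1], by linarith [hre.2]⟩

end LatticeLaplacian

section Eigenvectors

variable {d : ℕ}

/-- The cube of side length `2 n + 1` around the origin. -/
noncomputable def cube (d n : ℕ) : Finset (Vertex d) :=
  Finset.Icc (fun _ => -(n : ℤ)) fun _ => (n : ℤ)

theorem mem_cube {n : ℕ} {x : Vertex d} : x ∈ cube d n ↔ ∀ i, -(n : ℤ) ≤ x i ∧ x i ≤ n := by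
  simp only [cube, Finset.mem_Icc, Pi.le_def, forall_and]

theorem card_cube (d n : ℕ) : (cube d n).card = (2 * n + 1) ^ d := by
  rw [cube, Pi.card_Icc]
  simp only [Int.card_Icc, Finset.prod_const, Finset.card_univ, Fintype.card_fin]
  congr 1
  lia

theorem cube_subset_cube {m n : ℕ} (h : m ≤ n) : cube d m ⊆ cube d n := fun x hx => by
  rw [mem_cube] at hx ⊢
  intro i
  have := hx i
  lia

theorem add_mem_cube {n : ℕ} {x u : Vertex d} (hx : x ∈ cube d n) (hu : u ∈ units d) :
    x + u ∈ cube d (n + 1) := by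
  obtain ⟨j, s, hs, rfl⟩ := exists_eq_single_of_mem_units hu
  rw [mem_cube] at hx ⊢
  intro i
  have hxi := hx i
  rcases eq_or_ne i j with rfl | hij
  · rw [Pi.add_apply, Pi.single_eq_same]
    lia
  · rw [Pi.add_apply, Pi.single_eq_of_ne hij]
    lia

theorem exists_shell_le_mul_cube (d : ℕ) (C : ℝ) {ε : ℝ} (hε : 0 < ε) :
    ∃ n : ℕ, C * ((2 * ((n + 2 : ℕ) : ℝ) + 1) ^ d - (2 * (n : ℝ) + 1) ^ d) ≤
      ε * (2 * ((n + 1 : ℕ) : ℝ) + 1) ^ d := by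
  have hinv : Tendsto (fun n : ℕ => 2 / (2 * (n : ℝ) + 3)) atTop (𝓝 0) :=
    (tendsto_atTop_add_const_right _ _
      (tendsto_natCast_atTop_atTop.const_mul_atTop two_pos)).const_div_atTop 2
  have hratio : Tendsto (fun n : ℕ => C * ((1 + 2 / (2 * (n : ℝ) + 3)) ^ d -
      (1 - 2 / (2 * (n : ℝ) + 3)) ^ d)) atTop (𝓝 0) := by
    simpa using (((hinv.const_add 1).pow d).sub ((hinv.const_sub 1).pow d)).const_mul C
  obtain ⟨n, hn⟩ := (hratio.eventually_lt_const hε).exists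
  have houter : 2 * ((n + 2 : ℕ) : ℝ) + 1 = (1 + 2 / (2 * (n : ℝ) + 3)) * (2 * n + 3) := by
    push_cast
    field_simp
    ring
  have hinner : 2 * (n : ℝ) + 1 = (1 - 2 / (2 * (n : ℝ) + 3)) * (2 * n + 3) := by
    field_simp
    ring
  have hmiddle : 2 * ((n + 1 : ℕ) : ℝ) + 1 = 2 * n + 3 := by
    push_cast
    ring
  refine ⟨n, ?_⟩
  rw [houter, hinner, hmiddle, mul_pow, mul_pow, ← sub_mul, ← mul_assoc]
  gcongr

/-- The diagonal plane wave `x ↦ exp(iθ(x₁ + ⋯ + x_d))`. -/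
noncomputable def planeWave (θ : ℝ) (x : Vertex d) : ℂ :=
  Complex.exp ((θ * (∑ i, x i : ℤ) : ℝ) * Complex.I)

theorem norm_planeWave (θ : ℝ) (x : Vertex d) : ‖planeWave θ x‖ = 1 :=
  Complex.norm_exp_ofReal_mul_I _

theorem planeWave_add (θ : ℝ) (x y : Vertex d) :
    planeWave θ (x + y) = planeWave θ y * planeWave θ x := by
  simp only [planeWave, ← Complex.exp_add, Pi.add_apply, Finset.sum_add_distrib]
  push_cast
  ring_nf

theorem planeWave_single (θ : ℝ) (i : Fin d) (s : ℤ) :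
    planeWave θ (Pi.single i s) = Complex.exp (θ * s * Complex.I) := by
  simp [planeWave]

theorem sum_planeWave_units (d : ℕ) (θ : ℝ) :
    ∑ u ∈ units d, planeWave θ u = ((2 * d * Real.cos θ : ℝ) : ℂ) := by
  have hpair : ∀ u ∈ units d, planeWave θ u + planeWave θ (-u) = 2 * Complex.cos θ := by
    intro u hu
    obtain ⟨i, s, rfl | rfl, rfl⟩ := exists_eq_single_of_mem_units hu <;>
      simp [← Pi.single_neg, planeWave_single, Complex.two_cos, add_comm]
  refine mul_left_cancel₀ (two_ne_zero (α := ℂ)) ?_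
  calc 2 * ∑ u ∈ units d, planeWave θ u
      = ∑ u ∈ units d, (planeWave θ u + planeWave θ (-u)) := by
        rw [Finset.sum_add_distrib, sum_units_neg, two_mul]
    _ = 2 * ((2 * d * Real.cos θ : ℝ) : ℂ) := by
        rw [Finset.sum_congr rfl hpair, Finset.sum_const, card_units, nsmul_eq_mul]
        push_cast
        ring

/-- The dispersion relation: the energy of `planeWave θ` for the Laplacian of the full lattice. -/
noncomputable def waveEnergy (d : ℕ) (θ : ℝ) : ℝ := 2 * d - 2 * d * Real.cos θ

theorem exists_waveEnergy_eq (hd : 1 ≤ d) {E : ℝ} (hE : E ∈ Set.Icc (0 : ℝ) (4 * d)) :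
    ∃ θ, waveEnergy d θ = E := by
  have hd0 : (0 : ℝ) < d := by exact_mod_cast hd
  refine ⟨Real.arccos ((2 * d - E) / (2 * d)), ?_⟩
  rw [waveEnergy, Real.cos_arccos]
  · field_simp
    ring
  · rw [le_div_iff₀ (mul_pos two_pos hd0)]
    linarith [hE.2]
  · rw [div_le_one (mul_pos two_pos hd0)]
    linarith [hE.1]

/-- The restriction of `planeWave θ` to the cube of side length `2 n + 1`, as a vector of `ℓ²`. -/
noncomputable def truncatedWave (d : ℕ) (θ : ℝ) (n : ℕ) : L2 d :=
  ⟨(cube d n : Set (Vertex d)).indicator (planeWave θ), (memLp_two_iff _).2 <|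
    summable_of_ne_finset_zero (s := cube d n) fun x hx => by
      simp [Set.indicator_of_notMem (show x ∉ (cube d n : Set (Vertex d)) from hx)]⟩

theorem truncatedWave_of_mem {n : ℕ} {x : Vertex d} (θ : ℝ) (hx : x ∈ cube d n) :
    truncatedWave d θ n x = planeWave θ x :=
  Set.indicator_of_mem (show x ∈ (cube d n : Set (Vertex d)) from hx) _

theorem truncatedWave_of_notMem {n : ℕ} {x : Vertex d} (θ : ℝ) (hx : x ∉ cube d n) :
    truncatedWave d θ n x = 0 :=
  Set.indicator_of_notMem (show x ∉ (cube d n : Set (Vertex d)) from hx) _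

theorem norm_truncatedWave_apply_le (θ : ℝ) (n : ℕ) (x : Vertex d) :
    ‖truncatedWave d θ n x‖ ≤ 1 := by
  by_cases hx : x ∈ cube d n
  · rw [truncatedWave_of_mem θ hx, norm_planeWave]
  · simp [truncatedWave_of_notMem θ hx]

theorem norm_sq_truncatedWave (d : ℕ) (θ : ℝ) (n : ℕ) :
    ‖truncatedWave d θ n‖ ^ 2 = (2 * (n : ℝ) + 1) ^ d := by
  have hone : ∀ x ∈ cube d n, ‖truncatedWave d θ n x‖ ^ 2 = 1 := fun x hx => by
    rw [truncatedWave_of_mem θ hx, norm_planeWave, one_pow]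
  rw [norm_sq_eq_tsum, tsum_eq_sum (s := cube d n) fun x hx => by
    simp [truncatedWave_of_notMem θ hx], Finset.sum_congr rfl hone]
  simp [card_cube]

theorem truncatedWave_ne_zero (d : ℕ) (θ : ℝ) (n : ℕ) : truncatedWave d θ n ≠ 0 := fun h => by
  have hnorm := norm_sq_truncatedWave d θ n
  rw [h, norm_zero, zero_pow two_ne_zero] at hnorm
  exact hnorm.not_lt (by positivity)

theorem finite_support_truncatedWave (d : ℕ) (θ : ℝ) (n : ℕ) :
    {x | truncatedWave d θ n x ≠ 0}.Finite :=
  (cube d n).finite_toSet.subset fun _ hx => not_imp_comm.1 (truncatedWave_of_notMem θ) hx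

section FullLattice

variable (X : BoundaryCondition) {G : SimpleGraph (Vertex d)} (hG : G ≤ lattice d)

theorem laplacian_sub_waveEnergy_apply (hfull : lattice d ≤ G) (θ : ℝ) (φ : L2 d) (x : Vertex d) :
    (laplacian X hG φ - (waveEnergy d θ : ℂ) • φ : L2 d) x =
      ∑ u ∈ units d, (planeWave θ u * φ x - φ (x + u)) := by
  classical
  change laplacian X hG φ x - (waveEnergy d θ : ℂ) * φ x = _
  rw [laplacian_apply_eq_sum_units,
    Finset.sum_congr rfl fun u hu => if_pos (hfull (lattice_adj_add_iff.2 hu)),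
    Finset.sum_neg_distrib, Finset.sum_sub_distrib, ← Finset.sum_mul, sum_planeWave_units,
    waveEnergy]
  push_cast
  ring

theorem laplacian_sub_truncatedWave_apply_eq_zero (hfull : lattice d ≤ G) (θ : ℝ) {n : ℕ}
    {x : Vertex d} (hx : x ∉ cube d (n + 2) \ cube d n) :
    (laplacian X hG (truncatedWave d θ (n + 1)) -
      (waveEnergy d θ : ℂ) • truncatedWave d θ (n + 1) : L2 d) x = 0 := by
  rw [laplacian_sub_waveEnergy_apply X hG hfull]
  refine Finset.sum_eq_zero fun u hu => ?_
  by_cases hxn : x ∈ cube d n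
  · rw [truncatedWave_of_mem θ (cube_subset_cube n.le_succ hxn),
      truncatedWave_of_mem θ (add_mem_cube hxn hu), planeWave_add, sub_self]
  · have hxo : x ∉ cube d (n + 2) := fun h => hx (Finset.mem_sdiff.2 ⟨h, hxn⟩)
    have hxu : x + u ∉ cube d (n + 1) := fun h => by
      have := add_mem_cube h (neg_mem_units.2 hu)
      rw [add_neg_cancel_right] at this
      exact hxo this
    rw [truncatedWave_of_notMem θ fun h => hxo (cube_subset_cube (n + 1).le_succ h),
      truncatedWave_of_notMem θ hxu, mul_zero, sub_zero]

theorem norm_laplacian_sub_truncatedWave_apply_le (hfull : lattice d ≤ G) (θ : ℝ) (n : ℕ)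
    (x : Vertex d) :
    ‖(laplacian X hG (truncatedWave d θ n) -
      (waveEnergy d θ : ℂ) • truncatedWave d θ n : L2 d) x‖ ≤ 4 * d := by
  rw [laplacian_sub_waveEnergy_apply X hG hfull]
  refine (norm_sum_le_of_le (n := fun _ => 2) _ fun u _ => ?_).trans ?_
  · refine (norm_sub_le _ _).trans ?_
    rw [norm_mul, norm_planeWave, one_mul]
    linarith [norm_truncatedWave_apply_le θ n x, norm_truncatedWave_apply_le θ n (x + u)]
  · rw [Finset.sum_const, card_units, nsmul_eq_mul]
    push_cast
    linarith

theorem norm_sq_laplacian_sub_truncatedWave_le (hfull : lattice d ≤ G) (θ : ℝ) (n : ℕ) :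
    ‖laplacian X hG (truncatedWave d θ (n + 1)) -
      (waveEnergy d θ : ℂ) • truncatedWave d θ (n + 1)‖ ^ 2 ≤
        (4 * d) ^ 2 * ((2 * ((n + 2 : ℕ) : ℝ) + 1) ^ d - (2 * (n : ℝ) + 1) ^ d) := by
  have hsub : cube d n ⊆ cube d (n + 2) := cube_subset_cube (by lia)
  rw [norm_sq_eq_tsum, tsum_eq_sum (s := cube d (n + 2) \ cube d n) fun x hx => by
    rw [laplacian_sub_truncatedWave_apply_eq_zero X hG hfull θ hx, norm_zero,
      zero_pow two_ne_zero]]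
  refine (Finset.sum_le_card_nsmul _ _ ((4 * d : ℝ) ^ 2) fun x _ => ?_).trans_eq ?_
  · gcongr
    exact norm_laplacian_sub_truncatedWave_apply_le X hG hfull θ (n + 1) x
  · rw [nsmul_eq_mul, mul_comm, Finset.card_sdiff_of_subset hsub,
      Nat.cast_sub (Finset.card_le_card hsub), card_cube, card_cube]
    push_cast
    rfl

/-- The error of `truncatedWave d θ n` lives on a boundary shell of the cube, which has a small
fraction of the volume. -/
theorem exists_finite_support_approx_eigenvector (hd : 1 ≤ d) (hfull : lattice d ≤ G) {E : ℝ}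
    (hE : E ∈ Set.Icc (0 : ℝ) (4 * d)) {ε : ℝ} (hε : 0 < ε) :
    ∃ φ : L2 d, φ ≠ 0 ∧ {x | φ x ≠ 0}.Finite ∧
      ‖laplacian X hG φ - (E : ℂ) • φ‖ ≤ ε * ‖φ‖ := by
  obtain ⟨θ, rfl⟩ := exists_waveEnergy_eq hd hE
  obtain ⟨n, hn⟩ := exists_shell_le_mul_cube d ((4 * d) ^ 2) (pow_pos hε 2)
  refine ⟨truncatedWave d θ (n + 1), truncatedWave_ne_zero _ _ _,
    finite_support_truncatedWave _ _ _, le_of_sq_le_sq ?_ (by positivity)⟩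
  rw [mul_pow, norm_sq_truncatedWave]
  exact (norm_sq_laplacian_sub_truncatedWave_le X hG hfull θ n).trans hn

end FullLattice

theorem tendsto_translation_apply_zero {z : ℕ → Vertex d} (hz : Function.Injective z) (φ : L2 d)
    (x : Vertex d) : Tendsto (fun n => translation (z n) φ x) atTop (𝓝 0) := by
  have hcofinite : Tendsto (fun y => φ y) cofinite (𝓝 0) := by
    rw [tendsto_zero_iff_norm_tendsto_zero]
    simpa using ((summable_norm_sq φ).tendsto_cofinite_zero).sqrt
  rw [← Nat.cofinite_eq_atTop]
  exact hcofinite.comp ((sub_right_injective (b := x)).comp hz).tendsto_cofinite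

/-- A subsequence of the translates would converge in norm, to a limit with the norm of `φ` all of
whose coordinates vanish. -/
theorem not_finiteDimensional_of_translation_mem {V : Submodule ℂ (L2 d)} {φ : L2 d} (hφ : φ ≠ 0)
    {Z : Set (Vertex d)} (hZ : Z.Infinite) (h : ∀ z ∈ Z, translation z φ ∈ V) :
    ¬ FiniteDimensional ℂ V := by
  intro hV
  have hproper : ProperSpace V := FiniteDimensional.proper ℂ V
  let z := hZ.natEmbedding
  let v : ℕ → V := fun n => ⟨translation (z n : Vertex d) φ, h _ (z n).2⟩
  have hv : ∀ n, ‖v n‖ = ‖φ‖ := fun n => (translation (z n : Vertex d)).norm_map φ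
  obtain ⟨a, -, k, hk, ha⟩ := (isCompact_closedBall (0 : V) ‖φ‖).tendsto_subseq (x := v)
    fun n => mem_closedBall_zero_iff.2 (hv n).le
  have ha_norm : ‖a‖ = ‖φ‖ :=
    tendsto_nhds_unique (ha.norm.congr fun n => hv (k n)) tendsto_const_nhds
  have ha_zero : (a : L2 d) = 0 := by
    ext x
    have heval : Continuous fun w : V => (w : L2 d) x :=
      (lp.evalCLM ℂ (fun _ : Vertex d => ℂ) 2 x).continuous.comp continuous_subtype_val
    exact tendsto_nhds_unique ((heval.tendsto a).comp ha) <| tendsto_translation_apply_zero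
      (Subtype.val_injective.comp (z.injective.comp hk.injective)) φ x
  rw [← norm_ne_zero_iff, ← ha_norm, Submodule.coe_norm, ha_zero, norm_zero] at hφ
  exact hφ rfl

theorem le_spectralSubspace_pp_of_finiteDimensional {H : Type*} [NormedAddCommGroup H]
    [InnerProductSpace ℂ H] [CompleteSpace H] {A : H →L[ℂ] H} (hA : IsSelfAdjoint A)
    {V : Submodule ℂ H} [FiniteDimensional ℂ V] (hV : Set.MapsTo A V V) :
    V ≤ spectralSubspace A .pp := by
  intro φ hφ
  have : IsScalarTower ℝ (H →L[ℂ] H) H := ⟨fun _ _ _ => rfl⟩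
  let f : Polynomial ℝ →ₗ[ℝ] V :=
    { toFun := fun q => ⟨Polynomial.aeval A q φ, Polynomial.aeval_apply_smul_mem_of_le_comap'
        (q := V.restrictScalars ℝ) hφ q A hV⟩
      map_add' := fun q r => Subtype.ext (by simp)
      map_smul' := fun c q => Subtype.ext (by simp) }
  have hfinite : Module.Finite ℝ V := .trans ℂ V
  have hf : ¬ Function.Injective f := fun h =>
    Polynomial.not_finite (Module.Finite.of_injective f h)
  rw [injective_iff_map_eq_zero] at hf
  push Not at hf
  obtain ⟨q, hq, hq0⟩ := hf
  exact mem_pp_of_aeval_eq_zero hA hq0 (congrArg Subtype.val hq)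

open Classical in
/-- Multiplication by the indicator function of a set of vertices. -/
noncomputable def restrictTo (C : Set (Vertex d)) : L2 d →L[ℂ] L2 d :=
  mulOp (fun x => if x ∈ C then 1 else 0) 1 fun x => by split_ifs <;> simp

theorem restrictTo_of_mem {C : Set (Vertex d)} {x : Vertex d} (hx : x ∈ C) (φ : L2 d) :
    restrictTo C φ x = φ x := by
  rw [restrictTo, mulOp_apply, if_pos hx, one_mul]

theorem restrictTo_of_notMem {C : Set (Vertex d)} {x : Vertex d} (hx : x ∉ C) (φ : L2 d) :
    restrictTo C φ x = 0 := by
  rw [restrictTo, mulOp_apply, if_neg hx, zero_mul]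

theorem finiteDimensional_range_restrictTo {C : Set (Vertex d)} (hC : C.Finite) :
    FiniteDimensional ℂ (LinearMap.range (restrictTo C : L2 d →ₗ[ℂ] L2 d)) := by
  have := hC.to_subtype
  let f : L2 d →ₗ[ℂ] C → ℂ :=
    LinearMap.pi fun x => lp.evalₗ (𝕜 := ℂ) (fun _ : Vertex d => ℂ) 2 (x : Vertex d)
  refine FiniteDimensional.of_injective
    (f.domRestrict (LinearMap.range (restrictTo C : L2 d →ₗ[ℂ] L2 d))) ?_
  rw [injective_iff_map_eq_zero]
  rintro ⟨_, φ, rfl⟩ h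
  ext x
  by_cases hx : x ∈ C
  · exact congrFun h ⟨x, hx⟩
  · exact restrictTo_of_notMem hx φ

theorem laplacian_restrictTo (X : BoundaryCondition) {G : SimpleGraph (Vertex d)}
    (hG : G ≤ lattice d) {C : Set (Vertex d)} (hC : ∀ x y, G.Adj x y → (x ∈ C ↔ y ∈ C))
    (φ : L2 d) : laplacian X hG (restrictTo C φ) = restrictTo C (laplacian X hG φ) := by
  ext x
  have hy : ∀ y ∈ neighbors hG x, (x ∈ C ↔ y ∈ C) := fun y hy =>
    hC x y ((mem_neighbors hG x y).1 hy)
  by_cases hx : x ∈ C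
  · rw [restrictTo_of_mem hx, laplacian_apply, laplacian_apply, restrictTo_of_mem hx]
    congr 1
    exact Finset.sum_congr rfl fun y h => restrictTo_of_mem ((hy y h).1 hx) φ
  · rw [restrictTo_of_notMem hx, laplacian_apply, restrictTo_of_notMem hx,
      Finset.sum_eq_zero fun y h => restrictTo_of_notMem (fun hyC => hx ((hy y h).2 hyC)) φ]
    ring

theorem restrictTo_mem_spectralSubspace_pp (X : BoundaryCondition) {G : SimpleGraph (Vertex d)}
    (hG : G ≤ lattice d) {C : Set (Vertex d)} (hC : ∀ x y, G.Adj x y → (x ∈ C ↔ y ∈ C))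
    (hfin : C.Finite) (φ : L2 d) : restrictTo C φ ∈ spectralSubspace (laplacian X hG) .pp := by
  have := finiteDimensional_range_restrictTo hfin
  refine le_spectralSubspace_pp_of_finiteDimensional (isSelfAdjoint_laplacian X hG)
    (V := LinearMap.range (restrictTo C : L2 d →ₗ[ℂ] L2 d)) ?_ ⟨φ, rfl⟩
  rintro _ ⟨ψ, rfl⟩
  exact ⟨laplacian X hG ψ, (laplacian_restrictTo X hG hC ψ).symm⟩

end Eigenvectors

section Recurrence

variable {Ω : Type*} [MeasurableSpace Ω]

theorem measurableSet_setOf_infinite {ι : Type*} [Countable ι] {s : ι → Set Ω}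
    (hs : ∀ i, MeasurableSet (s i)) : MeasurableSet {ω | {i | ω ∈ s i}.Infinite} := by
  have hinter : {ω | {i | ω ∈ s i}.Infinite} =
      ⋂ B : Finset ι, ⋃ i : {i // i ∉ B}, s i := by
    ext ω
    simp only [Set.mem_iInter, Set.mem_iUnion, Subtype.exists, exists_prop]
    constructor
    · intro h B
      obtain ⟨i, hi, hiB⟩ := h.exists_notMem_finset B
      exact ⟨i, hiB, hi⟩
    · intro h hfin
      obtain ⟨i, hiB, hi⟩ := h hfin.toFinset
      exact hiB (hfin.mem_toFinset.2 hi)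
  rw [hinter]
  exact MeasurableSet.iInter fun B => MeasurableSet.iUnion fun i => hs i

theorem abs_measureReal_sub_mul_self_le {P : Measure Ω} [IsProbabilityMeasure P] {T : Ω → Ω}
    (hT : MeasurePreserving T P P) {s t : Set Ω} (hs : MeasurableSet s) (ht : MeasurableSet t)
    (hinv : T ⁻¹' s = s) (hmix : P.real (t ∩ T ⁻¹' t) = P.real t * P.real t) {ε : ℝ}
    (hts : P.real (symmDiff t s) ≤ ε) : |P.real s - P.real s * P.real s| ≤ 4 * ε := by
  have hsub : symmDiff (t ∩ T ⁻¹' t) s ⊆ symmDiff t s ∪ T ⁻¹' symmDiff t s := by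
    rw [Set.preimage_symmDiff, hinv]
    intro ω hω
    simp only [Set.mem_symmDiff, Set.mem_inter_iff, Set.mem_union] at hω ⊢
    tauto
  have hinter : P.real (symmDiff (t ∩ T ⁻¹' t) s) ≤ 2 * ε := by
    refine (measureReal_mono hsub).trans ((measureReal_union_le _ _).trans ?_)
    rw [hT.measureReal_preimage (ht.symmDiff hs).nullMeasurableSet]
    linarith
  have happrox : |P.real t - P.real s| ≤ ε :=
    (abs_measureReal_sub_le_measureReal_symmDiff ht.nullMeasurableSet
      hs.nullMeasurableSet).trans hts
  have happrox_inter : |P.real t * P.real t - P.real s| ≤ 2 * ε := by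
    rw [← hmix]
    exact (abs_measureReal_sub_le_measureReal_symmDiff
      (ht.inter (hT.measurable ht)).nullMeasurableSet hs.nullMeasurableSet).trans hinter
  have hsq : |P.real t * P.real t - P.real s * P.real s| ≤ 2 * ε := by
    have hsum : |P.real t + P.real s| ≤ 2 := by
      rw [abs_of_nonneg (by positivity)]
      linarith [measureReal_le_one (μ := P) (s := t), measureReal_le_one (μ := P) (s := s)]
    rw [mul_self_sub_mul_self, abs_mul]
    gcongr
  rw [abs_le] at happrox_inter hsq ⊢
  constructor <;> linarith [happrox_inter.1, happrox_inter.2, hsq.1, hsq.2]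

end Recurrence

section PercolationMeasure

variable {d : ℕ}

theorem Edge.shift_zero (e : Edge d) : e.shift 0 = e := by
  obtain ⟨e, he⟩ := e
  induction e with
  | _ x y => exact Subtype.ext (by simp [Edge.shift])

theorem Edge.shift_shift (z w : Vertex d) (e : Edge d) :
    (e.shift z).shift w = e.shift (z + w) := by
  obtain ⟨e, he⟩ := e
  induction e with
  | _ x y => exact Subtype.ext (by simp [Edge.shift, add_assoc])

/-- Translation by `z` as a permutation of the edges. -/
def Edge.shiftEquiv (z : Vertex d) : Edge d ≃ Edge d where
  toFun e := e.shift z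
  invFun e := e.shift (-z)
  left_inv e := by
    change (e.shift z).shift (-z) = e
    rw [Edge.shift_shift, add_neg_cancel, Edge.shift_zero]
  right_inv e := by
    change (e.shift (-z)).shift z = e
    rw [Edge.shift_shift, neg_add_cancel, Edge.shift_zero]

theorem Config.shift_zero (ω : Config d) : Config.shift 0 ω = ω :=
  funext fun e => congrArg ω e.shift_zero

theorem Config.shift_add (z w : Vertex d) (ω : Config d) :
    Config.shift (z + w) ω = Config.shift z (Config.shift w ω) :=
  funext fun e => congrArg ω (e.shift_shift z w).symm

theorem Config.shift_iterate (z : Vertex d) (n : ℕ) :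
    (Config.shift z)^[n] = Config.shift (n • z) := by
  induction n with
  | zero =>
    ext1 ω
    rw [zero_smul, Config.shift_zero]
    rfl
  | succ n ih =>
    ext1 ω
    rw [Function.iterate_succ_apply', ih, ← Config.shift_add, succ_nsmul']

theorem measurable_shift (z : Vertex d) : Measurable (Config.shift z) :=
  measurable_pi_lambda _ fun e => measurable_pi_apply (e.shift z)

instance (p : I) : IsProbabilityMeasure (percMeasure d p) := by
  unfold percMeasure
  infer_instance

theorem measurePreserving_shift (p : I) (z : Vertex d) :
    MeasurePreserving (Config.shift z) (percMeasure d p) (percMeasure d p) := by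
  have hcongr : (MeasurableEquiv.piCongrLeft (fun _ : Edge d => Bool) (Edge.shiftEquiv (-z)) :
      Config d → Config d) = Config.shift z := by
    ext ω e
    obtain ⟨e', rfl⟩ := (Edge.shiftEquiv (-z)).surjective e
    refine (Equiv.piCongrLeft_apply_apply (fun _ => Bool) (Edge.shiftEquiv (-z)) ω e').trans ?_
    change ω e' = ω ((e'.shift (-z)).shift z)
    rw [Edge.shift_shift, neg_add_cancel, Edge.shift_zero]
  refine ⟨measurable_shift z, ?_⟩
  rw [← hcongr]
  exact Measure.infinitePi_map_piCongrLeft (X := fun _ : Edge d => Bool)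
    (fun _ : Edge d => bernoulliMeasure true false p) (Edge.shiftEquiv (-z))

theorem finite_shift_eq (e e' : Edge d) : {z : Vertex d | e.shift z = e'}.Finite := by
  obtain ⟨e, he⟩ := e
  obtain ⟨e', he'⟩ := e'
  induction e with
  | _ x y =>
    induction e' with
    | _ x' y' =>
      refine (Set.toFinite {x' - x, y' - x}).subset fun z hz => ?_
      have hends : s(x + z, y + z) = s(x', y') := congrArg Subtype.val hz
      rw [Sym2.eq_iff] at hends
      rcases hends with ⟨h, -⟩ | ⟨h, -⟩
      · exact .inl (by rw [← h, add_sub_cancel_left])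
      · exact .inr (by rw [Set.mem_singleton_iff, ← h, add_sub_cancel_left])

theorem infinite_vertex (hd : 1 ≤ d) : Infinite (Vertex d) := by
  have : Nonempty (Fin d) := ⟨⟨0, hd⟩⟩
  exact Function.infinite_of_right

theorem exists_shift_disjoint (hd : 1 ≤ d) (F : Finset (Edge d)) :
    ∃ z : Vertex d, ∀ e ∈ F, e.shift z ∉ F := by
  have := infinite_vertex hd
  have hfin : (⋃ e ∈ F, ⋃ e' ∈ F, {z : Vertex d | e.shift z = e'}).Finite :=
    F.finite_toSet.biUnion fun e _ => F.finite_toSet.biUnion fun e' _ => finite_shift_eq e e'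
  obtain ⟨z, hz⟩ := hfin.infinite_compl.nonempty
  refine ⟨z, fun e he he' => hz ?_⟩
  simp only [Set.mem_iUnion]
  exact ⟨e, he, e.shift z, he', rfl⟩

theorem measure_cylinder_inter_shift (p : I) {F : Finset (Edge d)} {z : Vertex d}
    (hz : ∀ e ∈ F, e.shift z ∉ F) {S : Set (F → Bool)} (hS : MeasurableSet S) :
    percMeasure d p (cylinder F S ∩ Config.shift z ⁻¹' cylinder F S) =
      percMeasure d p (cylinder F S) * percMeasure d p (cylinder F S) := by
  classical
  let F' := F.image (Edge.shift z)
  have hdisj : Disjoint F F' := Finset.disjoint_left.2 fun e he he' => by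
    obtain ⟨e', he'F, rfl⟩ := Finset.mem_image.1 he'
    exact hz e' he'F he
  have hind := iIndepFun.indepFun_finset F F' hdisj
    (iIndepFun_infinitePi (P := fun _ : Edge d => bernoulliMeasure true false p)
      (X := fun _ b => b) fun _ => measurable_id) fun e => measurable_pi_apply e
  let r : (F' → Bool) → F → Bool := fun g e => g ⟨e.1.shift z, Finset.mem_image_of_mem _ e.2⟩
  have hr : Measurable r := measurable_pi_lambda _ fun e => measurable_pi_apply _
  have hpre := (measurePreserving_shift p z).measure_preimage
    (MeasurableSet.cylinder (α := fun _ : Edge d => Bool) F hS).nullMeasurableSet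
  conv_rhs => arg 2; rw [← hpre]
  exact hind.measure_inter_preimage_eq_mul S (r ⁻¹' S) hS (hr hS)

theorem exists_cylinder_symmDiff_le (p : I) {s : Set (Config d)} (hs : MeasurableSet s) {ε : ℝ}
    (hε : 0 < ε) : ∃ (F : Finset (Edge d)) (S : Set (F → Bool)), MeasurableSet S ∧
      (percMeasure d p).real (symmDiff (cylinder F S) s) ≤ ε := by
  have hcover : ∃ D : Set (Set (Config d)), D.Countable ∧
      D ⊆ measurableCylinders (fun _ : Edge d => Bool) ∧ percMeasure d p (⋃₀ D)ᶜ = 0 :=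
    ⟨{Set.univ}, Set.countable_singleton _,
      Set.singleton_subset_iff.2 (univ_mem_measurableCylinders _), by simp⟩
  obtain ⟨t, ht, hts⟩ := exists_measure_symmDiff_lt_of_generateFrom_isSetRing
    isSetAlgebra_measurableCylinders.isSetRing hcover generateFrom_measurableCylinders.symm hs
    (ENNReal.ofReal_pos.2 hε)
  obtain ⟨F, S, hS, rfl⟩ := (mem_measurableCylinders _).1 ht
  exact ⟨F, S, hS, ENNReal.toReal_le_of_le_ofReal hε.le hts.le⟩

theorem ergodic_shift (hd : 1 ≤ d) (p : I) {s : Set (Config d)} (hs : MeasurableSet s)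
    (hinv : ∀ z, Config.shift z ⁻¹' s = s) :
    percMeasure d p s = 0 ∨ percMeasure d p s = 1 := by
  set P := percMeasure d p
  have hdefect : ∀ ε > 0, |P.real s - P.real s * P.real s| ≤ ε := fun ε hε => by
    obtain ⟨F, S, hS, hFS⟩ := exists_cylinder_symmDiff_le p hs (ε := ε / 4) (by positivity)
    obtain ⟨z, hz⟩ := exists_shift_disjoint hd F
    have hmix := congrArg ENNReal.toReal (measure_cylinder_inter_shift p hz hS)
    rw [ENNReal.toReal_mul] at hmix
    have := abs_measureReal_sub_mul_self_le (measurePreserving_shift p z) hs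
      (MeasurableSet.cylinder (α := fun _ : Edge d => Bool) F hS) (hinv z) hmix hFS
    linarith
  have hidem : P.real s * (1 - P.real s) = 0 := by
    rw [mul_sub, mul_one, ← abs_nonpos_iff]
    exact le_of_forall_pos_le_add fun ε hε => by simpa using hdefect ε hε
  rcases mul_eq_zero.1 hidem with hzero | hone
  · exact .inl ((measureReal_eq_zero_iff (measure_ne_top P s)).1 hzero)
  · exact .inr ((ENNReal.toReal_eq_one_iff _).1 (sub_eq_zero.1 hone).symm)

theorem percGraph_shift_adj (z : Vertex d) (ω : Config d) (x y : Vertex d) :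
    (percGraph (Config.shift z ω)).Adj x y ↔ (percGraph ω).Adj (x + z) (y + z) := by
  constructor
  · rintro ⟨h, hω⟩
    exact ⟨lattice_adj_add z h, hω⟩
  · rintro ⟨h, hω⟩
    have hxy := lattice_adj_add (-z) h
    simp only [add_neg_cancel_right] at hxy
    exact ⟨hxy, hω⟩

theorem percLaplacian_covariant (X : BoundaryCondition) (z : Vertex d) (ω : Config d) (φ : L2 d) :
    percLaplacian X (Config.shift z ω) φ =
      (translation z).symm (percLaplacian X ω (translation z φ)) := by
  rw [LinearIsometryEquiv.eq_symm_apply]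
  exact (laplacian_translation X (percGraph_le _) (percGraph_le _) z φ
    fun x _ y => (percGraph_shift_adj z ω x y).symm).symm

theorem measurableSet_adj (x y : Vertex d) :
    MeasurableSet {ω : Config d | (percGraph ω).Adj x y} := by
  by_cases h : (lattice d).Adj x y
  · have hopen : {ω : Config d | (percGraph ω).Adj x y} = (fun ω => ω ⟨s(x, y), h⟩) ⁻¹' {true} := by
      ext ω
      exact ⟨fun ⟨_, hω⟩ => hω, fun hω => ⟨h, hω⟩⟩
    rw [hopen]
    exact measurable_pi_apply (X := fun _ : Edge d => Bool) _ (measurableSet_singleton true)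
  · have hempty : {ω : Config d | (percGraph ω).Adj x y} = ∅ :=
      Set.eq_empty_of_forall_notMem fun ω hω => h hω.1
    rw [hempty]
    exact MeasurableSet.empty

theorem measurable_percLaplacian_apply (X : BoundaryCondition) (φ : L2 d) (x : Vertex d) :
    Measurable fun ω : Config d => percLaplacian X ω φ x := by
  simp only [percLaplacian, laplacian_apply_eq_sum_units]
  exact (Finset.measurable_sum _ fun u _ =>
    Measurable.ite (measurableSet_adj x (x + u)) measurable_const measurable_const).const_add _

theorem isErgodicRandomOperator_percLaplacian (hd : 1 ≤ d) (X : BoundaryCondition) (p : I) :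
    IsErgodicRandomOperator (percMeasure d p) Config.shift translation
      (percLaplacian (d := d) X) where
  isSelfAdjoint ω := isSelfAdjoint_laplacian X (percGraph_le ω)
  measurable_inner φ ψ := measurable_of_hasSum
    (f := fun x ω => inner ℂ (φ x) (percLaplacian X ω ψ x))
    (fun x => Measurable.inner measurable_const (measurable_percLaplacian_apply X ψ x))
    fun ω => lp.hasSum_inner φ (percLaplacian X ω ψ)
  shift_zero := Config.shift_zero
  shift_add := Config.shift_add
  measurePreserving := measurePreserving_shift p
  ergodic _ hs hinv := ergodic_shift hd p hs hinv
  covariant := percLaplacian_covariant X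

/-- The cylinder event that the configuration agrees with `η` on the finite edge set `F`. -/
def agreeSet (F : Finset (Edge d)) (η : Config d) : Set (Config d) := {ω | ∀ e ∈ F, ω e = η e}

theorem agreeSet_eq_pi (F : Finset (Edge d)) (η : Config d) :
    agreeSet F η = (F : Set (Edge d)).pi fun e => {η e} := rfl

theorem measurableSet_agreeSet (F : Finset (Edge d)) (η : Config d) :
    MeasurableSet (agreeSet F η) := by
  rw [agreeSet_eq_pi]
  exact MeasurableSet.pi F.countable_toSet fun e _ => measurableSet_singleton _

theorem percMeasure_agreeSet_ne_zero {p : I} (hp0 : 0 < p) (hp1 : p < 1) (F : Finset (Edge d))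
    (η : Config d) : percMeasure d p (agreeSet F η) ≠ 0 := by
  classical
  have hopen : unitInterval.toNNReal p ≠ 0 := fun h =>
    (show (0 : ℝ) < p from hp0).ne' (congrArg NNReal.toReal h)
  have hclosed : unitInterval.toNNReal (unitInterval.symm p) ≠ 0 := fun h =>
    (sub_pos.2 (show (p : ℝ) < 1 from hp1)).ne' (congrArg NNReal.toReal h)
  rw [agreeSet_eq_pi, percMeasure, Measure.infinitePi_pi _ fun e _ => measurableSet_singleton _,
    Finset.prod_ne_zero_iff]
  intro e _
  rw [bernoulliMeasure_apply p (measurableSet_singleton _)]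
  cases η e <;> simp [hopen, hclosed]

theorem infinite_setOf_shift_mem_iff (s : Set (Config d)) (w : Vertex d) (ω : Config d) :
    {z | Config.shift z (Config.shift w ω) ∈ s}.Infinite ↔ {z | Config.shift z ω ∈ s}.Infinite := by
  have himage : {z | Config.shift z ω ∈ s} =
      (· + w) '' {z | Config.shift z (Config.shift w ω) ∈ s} := by
    ext z
    simp only [Set.image_add_right, Set.mem_preimage, Set.mem_ofPred_eq, ← Config.shift_add,
      neg_add_cancel_right]
  rw [himage, Set.infinite_image_iff (add_left_injective w).injOn]

theorem ae_infinite_shift_mem_of_mem (hd : 1 ≤ d) (p : I) {s : Set (Config d)}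
    (hs : MeasurableSet s) :
    ∀ᵐ ω ∂percMeasure d p, ω ∈ s → {z | Config.shift z ω ∈ s}.Infinite := by
  let e₀ : Vertex d := Pi.single ⟨0, hd⟩ 1
  have hinj : Function.Injective fun n : ℕ => n • e₀ := fun m n hmn => by
    simpa [e₀] using congrFun hmn ⟨0, hd⟩
  filter_upwards [(measurePreserving_shift p e₀).conservative.ae_mem_imp_frequently_image_mem
    hs.nullMeasurableSet] with ω hω hωs
  refine ((Nat.frequently_atTop_iff_infinite.1 (hω hωs)).image hinj.injOn).mono ?_
  rintro _ ⟨n, hn, rfl⟩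
  rwa [Set.mem_ofPred_eq, Config.shift_iterate] at hn

theorem ae_infinite_shift_mem (hd : 1 ≤ d) {p : I} {s : Set (Config d)} (hs : MeasurableSet s)
    (hpos : percMeasure d p s ≠ 0) :
    ∀ᵐ ω ∂percMeasure d p, {z | Config.shift z ω ∈ s}.Infinite := by
  have hmeas : MeasurableSet {ω | {z | Config.shift z ω ∈ s}.Infinite} :=
    measurableSet_setOf_infinite fun z => measurable_shift z hs
  rcases ergodic_shift hd p hmeas fun w => Set.ext (infinite_setOf_shift_mem_iff s w)
    with hzero | hone
  · exact absurd (measure_mono_null_ae (ae_infinite_shift_mem_of_mem hd p hs) hzero) hpos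
  · exact (mem_ae_iff_prob_eq_one hmeas).2 hone

/-- Every finite pattern `η|_F` occurs at infinitely many places in the configuration `ω`. -/
def IsPatternRich (ω : Config d) : Prop :=
  ∀ (F : Finset (Edge d)) (η : Config d), {z | Config.shift z ω ∈ agreeSet F η}.Infinite

theorem ae_isPatternRich (hd : 1 ≤ d) {p : I} (hp0 : 0 < p) (hp1 : p < 1) :
    ∀ᵐ ω ∂percMeasure d p, IsPatternRich ω := by
  classical
  have hcountable : ∀ᵐ ω ∂percMeasure d p, ∀ F T : Finset (Edge d),
      {z | Config.shift z ω ∈ agreeSet F fun e => decide (e ∈ T)}.Infinite :=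
    ae_all_iff.2 fun F => ae_all_iff.2 fun T => ae_infinite_shift_mem hd
      (measurableSet_agreeSet F _) (percMeasure_agreeSet_ne_zero hp0 hp1 F _)
  filter_upwards [hcountable] with ω hω F η
  refine (hω F (F.filter fun e => η e = true)).mono fun z hz e he => ?_
  rw [hz e he]
  cases h : η e <;> simp [he, h]

theorem finite_incident_edges {s : Set (Vertex d)} (hs : s.Finite) :
    {e : Edge d | ∃ x ∈ s, x ∈ e.1}.Finite := by
  have hfin : (Set.image2 (fun x u => s(x, x + u)) s (units d : Set (Vertex d))).Finite :=
    hs.image2 _ (units d).finite_toSet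
  refine (hfin.preimage Subtype.val_injective.injOn).subset ?_
  rintro ⟨e, he⟩ ⟨x, hx, y, rfl⟩
  obtain ⟨u, rfl⟩ : ∃ u, y = x + u := ⟨y - x, by simp⟩
  exact ⟨x, hx, u, lattice_adj_add_iff.1 he, rfl⟩

theorem IsPatternRich.infinite_translation_intertwine {ω : Config d} (hω : IsPatternRich ω)
    (X : BoundaryCondition) (η : Config d) {φ : L2 d} (hφ : {x | φ x ≠ 0}.Finite) :
    {z | percLaplacian X ω (translation z φ) =
      translation z (percLaplacian X η φ)}.Infinite := by
  have hF := finite_incident_edges hφ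
  refine (hω hF.toFinset η).mono fun z hz => ?_
  refine laplacian_translation X (percGraph_le η) (percGraph_le ω) z φ fun x hx y => ?_
  have hagree : ∀ h : (lattice d).Adj x y, Config.shift z ω ⟨s(x, y), h⟩ = η ⟨s(x, y), h⟩ :=
    fun h => hz _ (hF.mem_toFinset.2 ⟨x, hx, Sym2.mem_mk_left x y⟩)
  rw [← percGraph_shift_adj]
  exact exists_congr fun h => by rw [hagree h]

end PercolationMeasure

section Clusters

theorem measurableSet_isChain {Ω α : Type*} [MeasurableSpace Ω] {r : Ω → α → α → Prop}
    (hr : ∀ a b, MeasurableSet {ω | r ω a b}) (l : List α) :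
    MeasurableSet {ω | l.IsChain (r ω)} := by
  induction l with
  | nil => simp
  | cons a l ih =>
    cases l with
    | nil => simp
    | cons b l =>
      simp only [List.isChain_cons_cons]
      exact (hr a b).inter ih

theorem measurableSet_reflTransGen {Ω α : Type*} [MeasurableSpace Ω] [Countable α]
    {r : Ω → α → α → Prop} (hr : ∀ a b, MeasurableSet {ω | r ω a b}) (a b : α) :
    MeasurableSet {ω | Relation.ReflTransGen (r ω) a b} := by
  have hchain : {ω | Relation.ReflTransGen (r ω) a b} =
      ⋃ (l : List α) (_ : (a :: l).getLast (List.cons_ne_nil a l) = b),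
        {ω | (a :: l).IsChain (r ω)} := by
    ext ω
    simp only [Set.mem_iUnion, Set.mem_ofPred_eq, exists_prop]
    constructor
    · intro h
      obtain ⟨l, hl, hlast⟩ := List.exists_isChain_cons_of_relationReflTransGen h
      exact ⟨l, hlast, hl⟩
    · rintro ⟨l, hlast, hl⟩
      exact List.relationReflTransGen_of_exists_isChain_cons l hl hlast
  rw [hchain]
  exact MeasurableSet.iUnion fun l => MeasurableSet.iUnion fun _ => measurableSet_isChain hr _

theorem ofReal_eq_toNNReal (p : I) : ENNReal.ofReal p = unitInterval.toNNReal p :=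
  ENNReal.ofReal_eq_coe_nnreal p.2.1

theorem measurable_decide_le (p : I) : Measurable fun u : I => decide (u ≤ p) := by
  refine measurable_to_bool ?_
  simpa [Set.preimage, Set.Iic] using measurableSet_Iic (a := p)

theorem map_decide_le_volume (p : I) :
    (volume : Measure I).map (fun u => decide (u ≤ p)) = bernoulliMeasure true false p := by
  classical
  refine Measure.ext_of_singleton fun b => ?_
  rw [Measure.map_apply (measurable_decide_le p) (measurableSet_singleton b),
    bernoulliMeasure_apply p (measurableSet_singleton b)]
  cases b
  · have hpre : (fun u : I => decide (u ≤ p)) ⁻¹' {false} = Set.Ioi p := by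
      ext u
      simp
    rw [hpre, unitInterval.volume_Ioi]
    simpa using ofReal_eq_toNNReal (unitInterval.symm p)
  · have hpre : (fun u : I => decide (u ≤ p)) ⁻¹' {true} = Set.Iic p := by
      ext u
      simp
    rw [hpre, unitInterval.volume_Iic]
    simpa using ofReal_eq_toNNReal p

variable {d : ℕ}

/-- The configuration in which a bond is present iff its mark in `u` is at most `p`. Under
independent uniform marks it realises percolation for all `p` at once, monotonically in `p`. -/
noncomputable def thresholdConfig (p : I) (u : Edge d → I) : Config d :=
  fun e => decide (u e ≤ p)

theorem measurable_thresholdConfig (p : I) : Measurable (thresholdConfig (d := d) p) :=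
  measurable_pi_lambda _ fun e => (measurable_decide_le p).comp (measurable_pi_apply e)

theorem thresholdConfig_mono {p q : I} (hpq : p ≤ q) (u : Edge d → I) :
    thresholdConfig p u ≤ thresholdConfig q u := fun _ =>
  Bool.le_iff_imp.2 fun h => decide_eq_true ((of_decide_eq_true h).trans hpq)

theorem map_thresholdConfig (p : I) :
    (Measure.infinitePi fun _ : Edge d => (volume : Measure I)).map (thresholdConfig p) =
      percMeasure d p := by
  refine (Measure.infinitePi_map_pi _ (f := fun _ u => decide (u ≤ p))
    fun _ => measurable_decide_le p).trans ?_
  simp only [map_decide_le_volume, percMeasure]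

theorem measurableSet_reachable (x y : Vertex d) :
    MeasurableSet {ω : Config d | (percGraph ω).Reachable x y} := by
  simp only [SimpleGraph.reachable_iff_reflTransGen]
  exact measurableSet_reflTransGen measurableSet_adj x y

theorem measurableSet_infinite_clusterOf (x : Vertex d) :
    MeasurableSet {ω : Config d | (clusterOf ω x).Infinite} :=
  measurableSet_setOf_infinite (measurableSet_reachable x)

theorem percGraph_mono {ω ω' : Config d} (h : ω ≤ ω') : percGraph ω ≤ percGraph ω' :=
  fun _ _ ⟨hadj, hopen⟩ => ⟨hadj, top_le_iff.1 (hopen.ge.trans (h _))⟩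

theorem clusterOf_mono {ω ω' : Config d} (h : ω ≤ ω') (x : Vertex d) :
    clusterOf ω x ⊆ clusterOf ω' x :=
  fun _ hy => SimpleGraph.Reachable.mono (percGraph_mono h) hy

theorem percMeasure_infinite_clusterOf_mono {p q : I} (hpq : p ≤ q) (x : Vertex d) :
    percMeasure d p {ω | (clusterOf ω x).Infinite} ≤
      percMeasure d q {ω | (clusterOf ω x).Infinite} := by
  have hmeas := measurableSet_infinite_clusterOf x
  rw [← map_thresholdConfig p, ← map_thresholdConfig q,
    Measure.map_apply (measurable_thresholdConfig p) hmeas,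
    Measure.map_apply (measurable_thresholdConfig q) hmeas]
  exact measure_mono fun u hu => hu.mono (clusterOf_mono (thresholdConfig_mono hpq u) x)

theorem clusterOf_shift (z : Vertex d) (ω : Config d) (x : Vertex d) :
    clusterOf (Config.shift z ω) x = (· + z) ⁻¹' clusterOf ω (x + z) := by
  let f : percGraph (Config.shift z ω) ≃g percGraph ω :=
    ⟨Equiv.addRight z, fun {a b} => (percGraph_shift_adj z ω a b).symm⟩
  ext y
  exact (f.reachable_iff (u := x) (v := y)).symm

theorem percMeasure_infinite_clusterOf_eq_origin (p : I) (x : Vertex d) :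
    percMeasure d p {ω | (clusterOf ω x).Infinite} =
      percMeasure d p {ω | (clusterOf ω 0).Infinite} := by
  rw [← (measurePreserving_shift p x).measure_preimage
    (measurableSet_infinite_clusterOf 0).nullMeasurableSet]
  congr 1
  ext ω
  rw [Set.mem_preimage, Set.mem_ofPred_eq, Set.mem_ofPred_eq, clusterOf_shift, zero_add,
    ← Set.infinite_image_iff (s := (· + x) ⁻¹' clusterOf ω x) (add_left_injective x).injOn,
    Set.image_preimage_eq _ (add_right_surjective x)]

theorem percMeasure_infinite_clusterOf_eq_zero {p : I} (hp : (p : ℝ) < criticalProb d)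
    (x : Vertex d) : percMeasure d p {ω | (clusterOf ω x).Infinite} = 0 := by
  have hne : ((fun p : I => (p : ℝ)) ''
      {p | percMeasure d p {ω | (clusterOf ω 0).Infinite} = 0}).Nonempty := by
    by_contra hempty
    rw [criticalProb, Set.not_nonempty_iff_eq_empty.1 hempty, Real.sSup_empty] at hp
    exact absurd hp (not_lt.2 p.2.1)
  obtain ⟨_, ⟨q, hq, rfl⟩, hpq⟩ := exists_lt_of_lt_csSup hne hp
  rw [percMeasure_infinite_clusterOf_eq_origin]
  exact nonpos_iff_eq_zero.1 ((percMeasure_infinite_clusterOf_mono hpq.le 0).trans hq.le)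

theorem ae_finite_clusterOf {p : I} (hp : (p : ℝ) < criticalProb d) :
    ∀ᵐ ω ∂percMeasure d p, ∀ x, (clusterOf ω x).Finite := by
  refine ae_all_iff.2 fun x => ?_
  filter_upwards [measure_eq_zero_iff_ae_notMem.1 (percMeasure_infinite_clusterOf_eq_zero hp x)]
    with ω hω
  exact Set.not_infinite.1 hω

end Clusters

section Eigenvalues

theorem mem_spectrum_of_hasEigenvalue {K V : Type*} [Field K] [AddCommGroup V] [Module K V]
    [TopologicalSpace V] [IsTopologicalAddGroup V] [ContinuousConstSMul K V] {A : V →L[K] V}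
    {E : K} (h : Module.End.HasEigenvalue (A : V →ₗ[K] V) E) : E ∈ spectrum K A :=
  fun hunit => h.mem_spectrum (hunit.map ContinuousLinearMap.toLinearMapRingHom)

theorem exists_eigenvector_near_of_mem_spectrum {H : Type*} [NormedAddCommGroup H]
    [InnerProductSpace ℂ H] [CompleteSpace H] {A : H →L[ℂ] H} (hA : IsSelfAdjoint A)
    (hpp : spectralSubspace A .pp = ⊤) {E : ℂ} (hE : E ∈ spectrum ℂ A) {ε : ℝ} (hε : 0 < ε) :
    ∃ x : ℝ, ‖(x : ℂ) - E‖ < ε ∧ ∃ ψ ≠ 0, A ψ = (x : ℂ) • ψ := by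
  obtain ⟨φ, hφ⟩ := exists_spectralMeasure_ne_zero_of_mem_spectrum hA hE hε
  obtain ⟨ψ, hψ⟩ := exists_spectralMeasure_eq_restrict A φ (measurableSet_norm_sub_lt E ε)
  have hψpp : ψ ∈ spectralSubspace A .pp := hpp ▸ Submodule.mem_top
  obtain ⟨x, hx⟩ : ∃ x, spectralMeasure A ψ {x} ≠ 0 := by
    by_contra! hcont
    exact ne_zero_of_spectralMeasure_eq_restrict hψ hφ
      (eq_zero_of_mem_pp_of_forall_singleton hA hψpp hcont)
  refine ⟨x, ?_, exists_eigenvector_of_atom hA hx⟩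
  by_contra hfar
  have hdisj : {x} ∩ {y : ℝ | ‖(y : ℂ) - E‖ < ε} = ∅ := Set.singleton_inter_eq_empty.2 hfar
  rw [hψ, Measure.restrict_apply (measurableSet_singleton x), hdisj, measure_empty] at hx
  exact hx rfl

end Eigenvalues

section PercolationSpectrum

variable {d : ℕ} (X : BoundaryCondition) {ω : Config d}

/-- The standard Hilbert basis of `ℓ²(ℤ^d)`, needed as a countable total family when the
measurability of spectral projections is reduced to that of matrix elements. -/
noncomputable def standardBasis (d : ℕ) : HilbertBasis (Vertex d) ℂ (L2 d) :=
  HilbertBasis.ofRepr (LinearIsometryEquiv.refl ℂ (L2 d))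

theorem isSelfAdjoint_percLaplacian (ω : Config d) : IsSelfAdjoint (percLaplacian X ω) :=
  isSelfAdjoint_laplacian X (percGraph_le ω)

theorem IsPatternRich.spectrum_eq (hω : IsPatternRich ω) (hd : 1 ≤ d) :
    spectrum ℂ (percLaplacian X ω) = Complex.ofReal '' Set.Icc (0 : ℝ) (4 * d) := by
  refine (spectrum_laplacian_subset X (percGraph_le ω)).antisymm ?_
  rintro _ ⟨E, hE, rfl⟩
  refine mem_spectrum_of_approx_eigenvector fun ε hε => ?_
  obtain ⟨φ, hφ0, hfin, hle⟩ := exists_finite_support_approx_eigenvector X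
    (percGraph_le fun _ => true) hd (fun _ _ h => ⟨h, rfl⟩) hE hε
  obtain ⟨z, hz⟩ := (hω.infinite_translation_intertwine X (fun _ => true) hfin).nonempty
  have hintertwine : percLaplacian X ω (translation z φ) =
    translation z (percLaplacian X (fun _ => true) φ) := hz
  refine ⟨translation z φ, (translation z).map_eq_zero_iff.not.2 hφ0, ?_⟩
  rw [← percLaplacian, hintertwine, ← map_smul, ← map_sub, LinearIsometryEquiv.norm_map,
    LinearIsometryEquiv.norm_map]
  exact hle

theorem mem_clusterOf_iff_of_adj (v x y : Vertex d) (h : (percGraph ω).Adj x y) :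
    x ∈ clusterOf ω v ↔ y ∈ clusterOf ω v :=
  ⟨fun hx => SimpleGraph.Reachable.trans hx h.reachable,
    fun hy => SimpleGraph.Reachable.trans hy h.symm.reachable⟩

theorem spectralSubspace_percLaplacian_pp (hfin : ∀ x, (clusterOf ω x).Finite) :
    spectralSubspace (percLaplacian X ω) .pp = ⊤ := by
  refine spectralSubspace_pp_eq_top (isSelfAdjoint_percLaplacian X ω)
    (e := fun x : Vertex d => lp.single 2 x (1 : ℂ)) (fun ψ h => ?_) fun x => ?_
  · ext x
    exact (inner_single_one x ψ).symm.trans (h x)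
  · have hrestrict : restrictTo (clusterOf ω x) (lp.single 2 x (1 : ℂ)) = lp.single 2 x 1 := by
      ext y
      by_cases hy : y ∈ clusterOf ω x
      · exact restrictTo_of_mem hy _
      · have hyx : y ≠ x := fun h => hy (h ▸ SimpleGraph.Reachable.refl y)
        rw [restrictTo_of_notMem hy, lp.single_apply, Pi.single_eq_of_ne hyx]
    rw [← hrestrict]
    exact restrictTo_mem_spectralSubspace_pp X (percGraph_le ω) (mem_clusterOf_iff_of_adj x)
      (hfin x) _

/-- The energies of all finitely supported eigenvectors on arbitrary bond configurations. Below
the critical probability this is the non-random set of eigenvalues. -/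
def localizedEnergies (d : ℕ) (X : BoundaryCondition) : Set ℝ :=
  {E | ∃ (η : Config d) (φ : L2 d), φ ≠ 0 ∧ {x | φ x ≠ 0}.Finite ∧
    percLaplacian X η φ = (E : ℂ) • φ}

variable {X}

theorem mem_localizedEnergies_of_eigenvector (hfin : ∀ x, (clusterOf ω x).Finite) {E : ℝ}
    {φ : L2 d} (hφ : φ ≠ 0) (h : percLaplacian X ω φ = (E : ℂ) • φ) :
    E ∈ localizedEnergies d X := by
  obtain ⟨x, hx⟩ : ∃ x, φ x ≠ 0 := by
    by_contra! hzero
    exact hφ (lp.ext (funext hzero))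
  have hxC : x ∈ clusterOf ω x := SimpleGraph.Reachable.refl x
  refine ⟨ω, restrictTo (clusterOf ω x) φ, fun hzero => hx ?_, ?_, ?_⟩
  · rw [← restrictTo_of_mem hxC φ, hzero]
    rfl
  · exact (hfin x).subset fun y hy => not_imp_comm.1 (fun hyC => restrictTo_of_notMem hyC φ) hy
  · rw [percLaplacian, laplacian_restrictTo X (percGraph_le ω) (mem_clusterOf_iff_of_adj x),
      ← percLaplacian, h, map_smul]

theorem IsPatternRich.exists_infinite_translation_mem_eigenspace (hω : IsPatternRich ω) {E : ℝ}
    (hE : E ∈ localizedEnergies d X) :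
    ∃ φ : L2 d, φ ≠ 0 ∧ {z | translation z φ ∈
      Module.End.eigenspace (percLaplacian X ω : L2 d →ₗ[ℂ] L2 d) E}.Infinite := by
  obtain ⟨η, φ, hφ0, hfin, hη⟩ := hE
  refine ⟨φ, hφ0, (hω.infinite_translation_intertwine X η hfin).mono fun z hz => ?_⟩
  rw [Set.mem_ofPred_eq, hη, map_smul] at hz
  exact Module.End.mem_eigenspace_iff.2 hz

theorem IsPatternRich.hasEigenvalue (hω : IsPatternRich ω) {E : ℝ}
    (hE : E ∈ localizedEnergies d X) :
    Module.End.HasEigenvalue (percLaplacian X ω : L2 d →ₗ[ℂ] L2 d) E := by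
  obtain ⟨φ, hφ0, hinf⟩ := hω.exists_infinite_translation_mem_eigenspace hE
  obtain ⟨z, hz⟩ := hinf.nonempty
  exact Module.End.hasEigenvalue_of_hasEigenvector
    ⟨hz, (translation z).map_eq_zero_iff.not.2 hφ0⟩

theorem mem_localizedEnergies_of_hasEigenvalue (hfin : ∀ x, (clusterOf ω x).Finite) {E : ℂ}
    (hE : Module.End.HasEigenvalue (percLaplacian X ω : L2 d →ₗ[ℂ] L2 d) E) :
    E ∈ Complex.ofReal '' localizedEnergies d X := by
  obtain ⟨E, -, rfl⟩ := spectrum_laplacian_subset X (percGraph_le ω)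
    (mem_spectrum_of_hasEigenvalue hE)
  obtain ⟨φ, hφ⟩ := hE.exists_hasEigenvector
  exact ⟨E, mem_localizedEnergies_of_eigenvector hfin hφ.2 hφ.apply_eq_smul, rfl⟩

variable (X)

theorem IsPatternRich.setOf_hasEigenvalue_eq (hω : IsPatternRich ω)
    (hfin : ∀ x, (clusterOf ω x).Finite) :
    {E : ℂ | Module.End.HasEigenvalue (percLaplacian X ω : L2 d →ₗ[ℂ] L2 d) E} =
      Complex.ofReal '' localizedEnergies d X := by
  refine Set.Subset.antisymm (fun E hE => mem_localizedEnergies_of_hasEigenvalue hfin hE) ?_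
  rintro _ ⟨E, hE, rfl⟩
  exact hω.hasEigenvalue hE

theorem IsPatternRich.not_finiteDimensional_eigenspace (hω : IsPatternRich ω)
    (hfin : ∀ x, (clusterOf ω x).Finite) {E : ℂ}
    (hE : Module.End.HasEigenvalue (percLaplacian X ω : L2 d →ₗ[ℂ] L2 d) E) :
    ¬ FiniteDimensional ℂ
      (Module.End.eigenspace (percLaplacian X ω : L2 d →ₗ[ℂ] L2 d) E) := by
  obtain ⟨E, hElocal, rfl⟩ := mem_localizedEnergies_of_hasEigenvalue hfin hE
  obtain ⟨φ, hφ0, hinf⟩ := hω.exists_infinite_translation_mem_eigenspace hElocal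
  exact not_finiteDimensional_of_translation_mem hφ0 hinf fun z hz => hz

theorem IsPatternRich.closure_localizedEnergies (hω : IsPatternRich ω) (hd : 1 ≤ d)
    (hfin : ∀ x, (clusterOf ω x).Finite) :
    closure (localizedEnergies d X) = Set.Icc (0 : ℝ) (4 * d) := by
  have hspec := hω.spectrum_eq X hd
  refine (closure_minimal (fun E hE => ?_) isClosed_Icc).antisymm fun E hE => ?_
  · have hmem := mem_spectrum_of_hasEigenvalue (hω.hasEigenvalue hE)
    rwa [hspec, Complex.ofReal_injective.mem_set_image] at hmem
  · refine Metric.mem_closure_iff.2 fun ε hε => ?_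
    have hmem : (E : ℂ) ∈ spectrum ℂ (percLaplacian X ω) := hspec ▸ ⟨E, hE, rfl⟩
    obtain ⟨x, hx, ψ, hψ0, hψ⟩ := exists_eigenvector_near_of_mem_spectrum
      (isSelfAdjoint_percLaplacian X ω) (spectralSubspace_percLaplacian_pp X hfin) hmem hε
    refine ⟨x, mem_localizedEnergies_of_eigenvector hfin hψ0 hψ, ?_⟩
    rwa [dist_comm, Real.dist_eq, ← Real.norm_eq_abs, ← Complex.norm_real, Complex.ofReal_sub]

end PercolationSpectrum

end PercLap

theorem mainTheorem4 (d : ℕ) (hd : 1 ≤ d) (X : BoundaryCondition) (p : unitInterval)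
    (hp0 : 0 < p) (hp1 : p < 1) :
    IsErgodicRandomOperator (percMeasure d p) Config.shift translation (percLaplacian X) ∧
    (∀ᵐ ω ∂(percMeasure d p),
      spectrum ℂ (percLaplacian X ω) = Complex.ofReal '' Set.Icc (0 : ℝ) (4 * d)) ∧
    (∀ κ : SpectralType, ∃ T : Set ℝ, IsClosed T ∧ ∀ᵐ ω ∂(percMeasure d p),
      spectralComponent (percLaplacian X ω) κ = Complex.ofReal '' T) ∧
    ((p : ℝ) < criticalProb d →
      ∃ S : Set ℝ, closure S = Set.Icc (0 : ℝ) (4 * d) ∧ ∀ᵐ ω ∂(percMeasure d p),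
        spectralSubspace (percLaplacian X ω) .pp = ⊤ ∧
        spectralComponent (percLaplacian X ω) .pp =
          Complex.ofReal '' Set.Icc (0 : ℝ) (4 * d) ∧
        spectralComponent (percLaplacian X ω) .sc = ∅ ∧
        spectralComponent (percLaplacian X ω) .ac = ∅ ∧
        {E : ℂ | Module.End.HasEigenvalue (percLaplacian X ω : L2 d →ₗ[ℂ] L2 d) E} =
          Complex.ofReal '' S ∧
        ∀ E : ℂ, Module.End.HasEigenvalue (percLaplacian X ω : L2 d →ₗ[ℂ] L2 d) E →
          ¬ FiniteDimensional ℂ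
            (Module.End.eigenspace (percLaplacian X ω : L2 d →ₗ[ℂ] L2 d) E)) := by
  have hergodic := isErgodicRandomOperator_percLaplacian hd X p
  have hrich := ae_isPatternRich hd hp0 hp1
  refine ⟨hergodic, hrich.mono fun ω hω => hω.spectrum_eq X hd,
    fun κ => hergodic.exists_spectralComponent_eq (standardBasis d) κ,
    fun hpc => ⟨localizedEnergies d X, ?_, ?_⟩⟩
  · obtain ⟨ω, hω, hfin⟩ := (hrich.and (ae_finite_clusterOf hpc)).exists
    exact hω.closure_localizedEnergies X hd hfin
  · filter_upwards [hrich, ae_finite_clusterOf hpc] with ω hω hfin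
    have hA := isSelfAdjoint_percLaplacian X ω
    have hpp := spectralSubspace_percLaplacian_pp X hfin
    have hspec := (spectralComponent_eq_spectrum hA hpp).trans (hω.spectrum_eq X hd)
    exact ⟨hpp, hspec, spectralComponent_eq_empty hA hpp (by simp),
      spectralComponent_eq_empty hA hpp (by simp), hω.setOf_hasEigenvalue_eq X hfin,
      fun E hE => hω.not_finiteDimensional_eigenspace X hfin hE⟩
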